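/- A rooted ordered tree is a finite tree with a distinguished root in which the children of every vertex are linearly ordered; $|T|$ denotes the number of vertices of $T$. Let $\sigma(T)$ be the number of independent vertex subsets of $T$ (sets of pairwise non-adjacent vertices, including the empty set) and $\rho(T)$ the number of subtrees of $T$ (nonempty connected subgraphs). Let $\operatorname{SR}(z)=\sum_T \sigma(T)\rho(T)z^{|T|}$, the sum being over all rooted ordered trees $T$, and let $E(\sigma_n\rho_n)$ be the expected value of $\sigma(T_n)\rho(T_n)$, where $T_n$ is chosen uniformly at random among all rooted ordered trees with $n$ vertices. Then there is a real root $z_0\approx 0.0938166$ of the polynomial $125z^3-412z^2-40936z+3844$ that is the dominant singularity of $\operatorname{SR}$: the series converges absolutely and is analytic for $|z|<z_0$, it cannot be continued analytically to $z_0$, and it can be continued analytically to every other point of the circle $|z|=z_0$. Moreover there are real constants $a\approx 0.560623$ and $b\approx 0.683264$ such that, as $z\to z_0$ with $|z|<z_0$, $$\operatorname{SR}(z)=a-b\sqrt{1-\frac{z}{z_0}}+o\left(\sqrt{\left|1-\frac{z}{z_0}\right|}\right),$$ with the principal branch of the square root. Consequently $$E(\sigma_n\rho_n)\sim C\left(\frac{1}{4z_0}\right)^n\qquad(n\to\infty)$$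 for a constant $C\approx 1.36653$, where $\frac{1}{4z_0}\approx 2.66477$. Here $x\approx d$ means that $x$ differs from the displayed decimal $d$ by at most half a unit in its last digit. -/

import Mathlib

open Filter Topology Asymptotics

/-- Rooted ordered (plane) trees: a root with a finite list of branches, each again a rooted
ordered tree. -/
inductive OrderedTree : Type
  | node (branches : List OrderedTree) : OrderedTree

namespace OrderedTree

/-- The list of branches at the root. -/
def branches : OrderedTree → List OrderedTree
  | node ts => ts

/-- `IsVertex v t`: the address `v` leads to a vertex of `t`. The root has address `[]`; the
address `i :: v` belongs to the vertex with address `v` in the `i`-th branch (counted from `0`). -/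
def IsVertex : List ℕ → OrderedTree → Prop
  | [], _ => True
  | i :: v, t => ∃ h : i < t.branches.length, IsVertex v t.branches[i]

/-- The vertices of a rooted ordered tree. -/
def Vertex (t : OrderedTree) : Type := {v : List ℕ // IsVertex v t}

/-- The underlying graph: every vertex is joined to its children. -/
def graph (t : OrderedTree) : SimpleGraph t.Vertex where
  Adj u v := ∃ i : ℕ, v.1 = u.1 ++ [i] ∨ u.1 = v.1 ++ [i]
  symm := ⟨fun _ _ ⟨i, h⟩ => ⟨i, h.symm⟩⟩
  loopless := ⟨fun u ⟨i, h⟩ => by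
    rcases h with h | h <;> simpa using congrArg List.length h⟩

/-- The number `|t|` of vertices. -/
noncomputable def order (t : OrderedTree) : ℕ := Nat.card t.Vertex

/-- The σ-index: the number of independent vertex subsets, including the empty one. -/
noncomputable def sigmaIndex (t : OrderedTree) : ℕ :=
  Nat.card {s : Set t.Vertex // t.graph.IsIndepSet s}

/-- The ρ-index: the number of subtrees, i.e. of subgraphs that are (nonempty) trees. -/
noncomputable def rhoIndex (t : OrderedTree) : ℕ :=
  Nat.card {H : t.graph.Subgraph // H.coe.IsTree}

/-- A vertex is the root or a vertex of one of the branches. -/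
def vertexEquiv (t : OrderedTree) :
    t.Vertex ≃ Option (Σ i : Fin t.branches.length, Vertex t.branches[i]) where
  toFun
    | ⟨[], _⟩ => none
    | ⟨i :: v, h⟩ => some ⟨⟨i, h.1⟩, ⟨v, h.2⟩⟩
  invFun
    | none => ⟨[], trivial⟩
    | some x => ⟨x.1.1 :: x.2.1, ⟨x.1.2, x.2.2⟩⟩
  left_inv := by rintro ⟨_ | ⟨i, v⟩, h⟩ <;> rfl
  right_inv := by rintro (_ | x) <;> rfl

theorem finite_vertex : ∀ t : OrderedTree, Finite t.Vertex
  | node ts => by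
    have : ∀ i : Fin (node ts).branches.length, Finite (Vertex (node ts).branches[i]) :=
      fun i => finite_vertex (ts[i.1]'i.2)
    exact Finite.of_equiv _ (vertexEquiv (node ts)).symm
decreasing_by
  have h : sizeOf (ts[i.1]'i.2) < sizeOf ts := List.sizeOf_lt_of_mem (List.getElem_mem _)
  exact h.trans (by simp)

instance (t : OrderedTree) : Finite t.Vertex := finite_vertex t

theorem order_eq (t : OrderedTree) :
    t.order = 1 + ∑ i : Fin t.branches.length, t.branches[i].order := by
  unfold order
  rw [Nat.card_congr (vertexEquiv t), Finite.card_option, Nat.card_sigma, add_comm]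

theorem order_pos (t : OrderedTree) : 0 < t.order := by rw [order_eq]; omega

theorem finite_order_le (n : ℕ) : {t : OrderedTree | t.order ≤ n}.Finite := by
  induction n with
  | zero =>
    convert Set.finite_empty
    ext t
    simpa using (order_pos t).ne'
  | succ n ih =>
    have : Finite {t : OrderedTree | t.order ≤ n} := ih
    refine ((List.finite_length_le {t : OrderedTree | t.order ≤ n} n).image
      (fun l => node (l.map Subtype.val))).subset ?_
    rintro ⟨ts⟩ h
    have h1 : 1 + ∑ i : Fin ts.length, ts[i].order ≤ n + 1 := (order_eq (node ts)).symm.trans_le h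
    have h2 : ∀ t ∈ ts, t.order ≤ n := by
      intro t ht
      obtain ⟨i, hi, rfl⟩ := List.getElem_of_mem ht
      have := Finset.single_le_sum (f := fun i : Fin ts.length => ts[i].order)
        (fun _ _ => Nat.zero_le _) (Finset.mem_univ ⟨i, hi⟩)
      simp only [Fin.getElem_fin] at this h1
      omega
    have h3 : ts.length ≤ n := by
      have := Finset.card_nsmul_le_sum Finset.univ (fun i : Fin ts.length => ts[i].order) 1
        (fun i _ => order_pos _)
      simp only [Finset.card_univ, Fintype.card_fin, smul_eq_mul, mul_one] at this
      omega
    refine ⟨ts.attach.map fun t => ⟨t.1, h2 _ t.2⟩, ?_, ?_⟩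
    · simpa using h3
    · simp [List.map_map, Function.comp_def]

theorem finite_order_eq (n : ℕ) : {t : OrderedTree | t.order = n}.Finite :=
  (finite_order_le n).subset fun _ h => le_of_eq h

/-- The finite set of all rooted ordered trees with `n` vertices. -/
noncomputable def treesOfOrder (n : ℕ) : Finset OrderedTree := (finite_order_eq n).toFinset

/-- The expected value of `X(T_n)`, where `T_n` is selected uniformly at random among all rooted
ordered trees with `n` vertices. -/
noncomputable def expectation (X : OrderedTree → ℝ) (n : ℕ) : ℝ :=
  (∑ t ∈ treesOfOrder n, X t) / (treesOfOrder n).card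

/-- The generating function `SR(z) = ∑_T σ(T) ρ(T) z^|T|`, summed over all rooted ordered trees. -/
noncomputable def SR (z : ℂ) : ℂ :=
  ∑' t : OrderedTree, (t.sigmaIndex : ℂ) * (t.rhoIndex : ℂ) * z ^ t.order

end OrderedTree

/-- `f`, considered on the open disc of radius `r` around `0`, has an analytic continuation to a
neighbourhood of the point `w`. -/
def ContinuesAnalyticallyAt (f : ℂ → ℂ) (r : ℝ) (w : ℂ) : Prop :=
  ∃ g : ℂ → ℂ, AnalyticAt ℂ g w ∧ g =ᶠ[𝓝[Metric.ball 0 r] w] f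

/-- `ζ` is the dominant singularity of `f`: `f` is analytic in the open disc `|z| < |ζ|`, cannot be
continued analytically to `ζ`, and can be continued analytically to every other point of the
circle `|z| = |ζ|`. -/
structure IsDominantSingularity (f : ℂ → ℂ) (ζ : ℂ) : Prop where
  analyticOnNhd : AnalyticOnNhd ℂ f (Metric.ball 0 ‖ζ‖)
  singular : ¬ ContinuesAnalyticallyAt f ‖ζ‖ ζ
  regular : ∀ w : ℂ, ‖w‖ = ‖ζ‖ → w ≠ ζ → ContinuesAnalyticallyAt f ‖ζ‖ w

/-!
Let `σ₀(t)` and `σ₁(t)` count the independent sets of `t` without and with the root, and let `r(t)`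
count the subtrees that contain the root. If `t` has the branches `tᵢ`, then
`σ₀(t) = ∏ σ(tᵢ)`, `σ₁(t) = ∏ σ₀(tᵢ)`, `r(t) = ∏ (1 + r(tᵢ))` and `ρ(t) = r(t) + ∑ ρ(tᵢ)`
(`sigmaOut_node`, `sigmaIn_node`, `rootedRho_node`, `rhoIndex_node`). To see this, vertex sets are
encoded as sets of addresses; a subtree is a set of addresses with a top address that is closed
under passing to the parent up to the top (`rhoIndex_eq_card`).

Sums over trees are sums over lists of trees, so the generating functions `y` of `σ₀`, `s` of `σ₁`,
`u₀` of `σ₀ r` and `u₁` of `σ₁ r` satisfy a polynomial system, and `SR` is given by a linear system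
over these. The system has a rational parametrization: with `v = u₀ / (1 - y)`,
`y = v (1 - v)² / (1 + v - v²)`, `z = y (1 - y)²`,
`SR = (1 - y)³ ((1 + y) v + y / (1 - v)) / (1 - 3 y)` (`genFun_system`, `SR_eq_paramSR`).
The smallest positive critical point of `z` as a function of `v` is the root `critV` of
`v³ - v² - 3 v + 1`; the values of `y` and `z` there are `critY` and `critZ`. By induction on the
number of vertices, the series with nonnegative coefficients for `y` and `u₀` converge at `critZ`,
with sums at most `critY` and `(1 - critY) critV` (`convergesAt_critZ`). Hence `v` is continuous on
the closed disc of radius `critZ` with values in the closed disc of radius `critV`. Of these values,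
only `v = critV`, taken only at `z = critZ`, is a zero of the derivative of `z` with respect to `v`
(`deriv_paramZ_ne_zero`). At all other points of the
circle the parametrization is locally invertible and `SR` continues analytically
(`exists_continuation_of_ne`). At `critZ`, `1 - z / critZ = (critV - v)² k(v)` with
`k(critV) > 0`, so `v`, and with it `SR`, is an analytic function of `√(1 - z / critZ)`
(`exists_singular_expansion`); the coefficient of the square root is not zero.

The coefficients are obtained by Darboux's method. When suitable multiples of `√(1 - z / critZ)` and
of its cube are subtracted, the second derivative of the rest is bounded in the disc
(`exists_bounded_remainder`), so that by Cauchy's estimate its coefficients are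
`O(critZ⁻ⁿ n⁻²)`. The coefficients of `√(1 - z / critZ)` are `-2 Cat(n - 1) / (4 critZ)ⁿ`
for `n ≥ 1`, and there are `Cat(n - 1)` trees with `n` vertices, so the expected value is asymptotically
`2 b (1 / (4 critZ))ⁿ`, where `-b` is the coefficient of the square root.
-/

open scoped ENNReal

/-! ### Vertex subsets as sets of addresses -/

namespace OrderedTree

theorem isVertex_of_append : ∀ (v w : List ℕ) (t : OrderedTree), IsVertex (v ++ w) t → IsVertex v t
  | [], _, _, _ => trivial
  | _ :: v, w, _, ⟨h, h'⟩ => ⟨h, isVertex_of_append v w _ h'⟩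

/-- Structural induction on rooted ordered trees. -/
theorem branchInduction {P : OrderedTree → Prop}
    (h : ∀ l : List OrderedTree, (∀ t ∈ l, P t) → P (node l)) : ∀ t, P t
  | node l => h l fun t _ => branchInduction h t
decreasing_by
  have h : sizeOf t < sizeOf l := List.sizeOf_lt_of_mem (by assumption)
  exact h.trans (by simp)

/-- The addresses in `s` form an independent set of vertices of `t`. -/
def IsIndep (t : OrderedTree) (s : Set (List ℕ)) : Prop :=
  (∀ v ∈ s, IsVertex v t) ∧ ∀ v i, v ∈ s → v ++ [i] ∉ s

/-- The addresses in `s` form a set of vertices of `t` that contains with every vertex its parent: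
the empty set, or the vertex set of a subtree containing the root. -/
def IsPrefixClosed (t : OrderedTree) (s : Set (List ℕ)) : Prop :=
  (∀ v ∈ s, IsVertex v t) ∧ ∀ v i, v ++ [i] ∈ s → v ∈ s

/-- The addresses in `s` form the vertex set of a subtree of `t`, whose vertex closest to the root
is `p`. -/
def IsSubtreeAt (t : OrderedTree) (p : List ℕ) (s : Set (List ℕ)) : Prop :=
  (∀ v ∈ s, IsVertex v t) ∧ p ∈ s ∧ (∀ v ∈ s, p <+: v) ∧ ∀ v i, v ++ [i] ∈ s → v ++ [i] ≠ p → v ∈ s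

theorem finite_addresses (t : OrderedTree) : {v : List ℕ | IsVertex v t}.Finite :=
  finite_vertex t

theorem finite_sets_of_vertices {t : OrderedTree} {P : Set (List ℕ) → Prop}
    (h : ∀ s, P s → ∀ v ∈ s, IsVertex v t) : Finite {s // P s} :=
  ((finite_addresses t).powerset).subset fun s hs v hv => h s hs v hv

/-- A family of sets of addresses that is described by the status of the root and by conditions on
the traces in the branches is counted by a product over the branches. -/
theorem card_eq_prod_of_traces {k : ℕ} {P : Set (List ℕ) → Prop} (b : Prop)
    (Q : Fin k → Set (List ℕ) → Prop)
    (hP : ∀ s, P s ↔ ([] ∈ s ↔ b) ∧ (∀ i v, i :: v ∈ s → i < k) ∧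
      ∀ i : Fin k, Q i {v | i.1 :: v ∈ s}) :
    Nat.card {s // P s} = ∏ i, Nat.card {s // Q i s} := by
  rw [← Nat.card_pi]
  refine Nat.card_eq_of_bijective
    (fun s i => ⟨{v | i.1 :: v ∈ s.1}, ((hP s.1).1 s.2).2.2 i⟩) ⟨?_, ?_⟩
  · intro s s' h
    have hs := (hP s.1).1 s.2
    have hs' := (hP s'.1).1 s'.2
    apply Subtype.ext
    ext v
    rcases v with _ | ⟨i, v⟩
    · exact hs.1.trans hs'.1.symm
    · have key : ∀ hi : i < k, i :: v ∈ s.1 ↔ i :: v ∈ s'.1 := fun hi => by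
        have := congrArg Subtype.val (congrFun h ⟨i, hi⟩)
        exact Set.ext_iff.1 this v
      exact ⟨fun h => (key (hs.2.1 i v h)).1 h, fun h => (key (hs'.2.1 i v h)).2 h⟩
  · intro f
    let s : Set (List ℕ) := {v | (v = [] ∧ b) ∨ ∃ i : Fin k, ∃ w ∈ (f i).1, v = i.1 :: w}
    have hs : ∀ i : Fin k, {v | i.1 :: v ∈ s} = (f i).1 := by
      intro i
      ext v
      constructor
      · rintro (h | ⟨j, w, hw, h⟩)
        · simp at h
        · simp only [List.cons.injEq] at h
          obtain ⟨h1, rfl⟩ := h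
          rwa [Fin.ext h1]
      · intro hv
        exact Or.inr ⟨i, v, hv, rfl⟩
    refine ⟨⟨s, (hP s).2 ⟨by simp [s], ?_, fun i => ?_⟩⟩, ?_⟩
    · rintro i v (h | ⟨j, w, hw, h⟩)
      · simp at h
      · simp only [List.cons.injEq] at h
        exact h.1 ▸ j.2
    · rw [hs]; exact (f i).2
    · funext i
      exact Subtype.ext (hs i)

theorem card_eq_add_card {P : Set (List ℕ) → Prop} {t : OrderedTree}
    (h : ∀ s, P s → ∀ v ∈ s, IsVertex v t) :
    Nat.card {s // P s} = Nat.card {s // P s ∧ [] ∉ s} + Nat.card {s // P s ∧ [] ∈ s} := by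
  classical
  have := finite_sets_of_vertices h
  have h1 : Finite {s // P s ∧ [] ∉ s} := finite_sets_of_vertices fun s hs => h s hs.1
  have h2 : Finite {s // P s ∧ [] ∈ s} := finite_sets_of_vertices fun s hs => h s hs.1
  rw [← Nat.card_sum]
  refine (Nat.card_eq_of_bijective
    (Sum.elim (fun s => ⟨s.1, s.2.1⟩) (fun s => ⟨s.1, s.2.1⟩)) ⟨?_, ?_⟩).symm
  · rintro (⟨s, hs⟩ | ⟨s, hs⟩) (⟨s', hs'⟩ | ⟨s', hs'⟩) h <;> simp at h <;> subst h
    · rfl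
    · exact absurd hs'.2 hs.2
    · exact absurd hs.2 hs'.2
    · rfl
  · rintro ⟨s, hs⟩
    by_cases h0 : [] ∈ s
    · exact ⟨.inr ⟨s, hs, h0⟩, rfl⟩
    · exact ⟨.inl ⟨s, hs, h0⟩, rfl⟩

/-- The number of independent sets that avoid the root. -/
noncomputable def sigmaOut (t : OrderedTree) : ℕ := Nat.card {s // IsIndep t s ∧ [] ∉ s}

/-- The number of independent sets that contain the root. -/
noncomputable def sigmaIn (t : OrderedTree) : ℕ := Nat.card {s // IsIndep t s ∧ [] ∈ s}

/-- The number of subtrees that contain the root. -/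
noncomputable def rootedRho (t : OrderedTree) : ℕ := Nat.card {s // IsPrefixClosed t s ∧ [] ∈ s}

theorem sigmaIndex_eq_card (t : OrderedTree) : t.sigmaIndex = Nat.card {s // IsIndep t s} := by
  refine Nat.card_eq_of_bijective (fun s => ⟨Subtype.val '' s.1, ?_, ?_⟩) ⟨?_, ?_⟩
  · rintro _ ⟨v, _, rfl⟩
    exact v.2
  · rintro _ i ⟨v, hv, rfl⟩ ⟨w, hw, h⟩
    have hne : v ≠ w := by
      rintro rfl
      simpa using congrArg List.length h
    exact s.2 hv hw hne ⟨i, Or.inl h⟩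
  · intro s s' h
    exact Subtype.ext (Subtype.val_injective.image_injective (congrArg Subtype.val h))
  · rintro ⟨s, h1, h2⟩
    refine ⟨⟨{v | v.1 ∈ s}, ?_⟩, ?_⟩
    · rintro u hu v hv _ ⟨i, h | h⟩
      · exact h2 u.1 i hu (h ▸ hv)
      · exact h2 v.1 i hv (h ▸ hu)
    · apply Subtype.ext
      ext v
      exact ⟨by rintro ⟨w, hw, rfl⟩; exact hw, fun hv => ⟨⟨v, h1 v hv⟩, hv, rfl⟩⟩

theorem sigmaIndex_eq_add (t : OrderedTree) : t.sigmaIndex = t.sigmaOut + t.sigmaIn := by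
  rw [sigmaIndex_eq_card]
  exact card_eq_add_card (t := t) fun s hs => hs.1

theorem sigmaOut_node (l : List OrderedTree) : (node l).sigmaOut = (l.map sigmaIndex).prod := by
  rw [sigmaOut, card_eq_prod_of_traces False (fun i s => IsIndep l[i] s),
    ← Fin.prod_univ_fun_getElem]
  · simp only [sigmaIndex_eq_card]; rfl
  · intro s
    constructor
    · rintro ⟨⟨h1, h2⟩, h0⟩
      exact ⟨by simpa using h0, fun i v hv => (h1 _ hv).1, fun i =>
        ⟨fun v hv => (h1 _ hv).2, fun v j hv => h2 _ _ hv⟩⟩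
    · rintro ⟨h0, h1, h2⟩
      have h0' : [] ∉ s := by simpa using h0
      refine ⟨⟨?_, ?_⟩, h0'⟩
      · rintro (_ | ⟨i, v⟩) hv
        · trivial
        · exact ⟨h1 _ _ hv, (h2 ⟨i, h1 _ _ hv⟩).1 v hv⟩
      · rintro (_ | ⟨i, v⟩) j hv
        · exact absurd hv h0'
        · exact (h2 ⟨i, h1 _ _ hv⟩).2 v j hv

theorem sigmaIn_node (l : List OrderedTree) : (node l).sigmaIn = (l.map sigmaOut).prod := by
  rw [sigmaIn, card_eq_prod_of_traces True (fun i s => IsIndep l[i] s ∧ [] ∉ s),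
    ← Fin.prod_univ_fun_getElem]
  · rfl
  · intro s
    constructor
    · rintro ⟨⟨h1, h2⟩, h0⟩
      exact ⟨by simpa using h0, fun i v hv => (h1 _ hv).1, fun i =>
        ⟨⟨fun v hv => (h1 _ hv).2, fun v j hv => h2 _ _ hv⟩, fun hv => h2 [] _ h0 hv⟩⟩
    · rintro ⟨h0, h1, h2⟩
      have h0' : [] ∈ s := by simpa using h0
      refine ⟨⟨?_, ?_⟩, h0'⟩
      · rintro (_ | ⟨i, v⟩) hv
        · trivial
        · exact ⟨h1 _ _ hv, (h2 ⟨i, h1 _ _ hv⟩).1.1 v hv⟩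
      · rintro (_ | ⟨i, v⟩) j hv hv'
        · exact (h2 ⟨j, h1 j [] hv'⟩).2 hv'
        · exact (h2 ⟨i, h1 _ _ hv⟩).1.2 v j hv hv'

theorem IsPrefixClosed.nil_mem {t : OrderedTree} {s : Set (List ℕ)} (h : IsPrefixClosed t s)
    (v : List ℕ) : v ∈ s → [] ∈ s := by
  induction v using List.reverseRecOn with
  | nil => exact id
  | append_singleton v i ih => exact fun hv => ih (h.2 v i hv)

theorem card_isPrefixClosed (t : OrderedTree) :
    Nat.card {s // IsPrefixClosed t s} = 1 + t.rootedRho := by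
  rw [card_eq_add_card (t := t) fun s hs => hs.1, rootedRho]
  congr 1
  rw [Nat.card_eq_one_iff_unique]
  refine ⟨⟨?_⟩, ⟨∅, ⟨by simp, by simp⟩, by simp⟩⟩
  have : ∀ s : {s // IsPrefixClosed t s ∧ [] ∉ s}, s.1 = ∅ := fun s =>
    Set.eq_empty_of_forall_notMem fun v hv => s.2.2 (s.2.1.nil_mem v hv)
  exact fun a b => Subtype.ext ((this a).trans (this b).symm)

theorem rootedRho_node (l : List OrderedTree) :
    (node l).rootedRho = (l.map fun t => 1 + t.rootedRho).prod := by
  rw [rootedRho, card_eq_prod_of_traces True (fun i s => IsPrefixClosed l[i] s),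
    ← Fin.prod_univ_fun_getElem]
  · simp only [card_isPrefixClosed]; rfl
  · intro s
    constructor
    · rintro ⟨⟨h1, h2⟩, h0⟩
      exact ⟨by simpa using h0, fun i v hv => (h1 _ hv).1, fun i =>
        ⟨fun v hv => (h1 _ hv).2, fun v j hv => h2 _ _ hv⟩⟩
    · rintro ⟨h0, h1, h2⟩
      have h0' : [] ∈ s := by simpa using h0
      refine ⟨⟨?_, ?_⟩, h0'⟩
      · rintro (_ | ⟨i, v⟩) hv
        · trivial
        · exact ⟨h1 _ _ hv, (h2 ⟨i, h1 _ _ hv⟩).1 v hv⟩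
      · rintro (_ | ⟨i, v⟩) j hv
        · exact h0'
        · exact (h2 ⟨i, h1 _ _ hv⟩).2 v j hv

theorem order_node (l : List OrderedTree) : (node l).order = 1 + (l.map order).sum := by
  rw [order_eq, ← Fin.sum_univ_fun_getElem]; rfl

end OrderedTree

/-! ### Subtrees as sets of addresses -/

namespace OrderedTree

/-- Every edge is a bridge: deleting the edge above a vertex separates the descendants of that
vertex from the rest of the tree. -/
theorem graph_isAcyclic (t : OrderedTree) : t.graph.IsAcyclic := by
  have key : ∀ u v : t.Vertex, ∀ i, v.1 = u.1 ++ [i] → t.graph.IsBridge s(u, v) := by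
    intro u v i huv
    rw [SimpleGraph.isBridge_iff]
    rintro ⟨w⟩
    have step : ∀ x y : t.Vertex, ∀ j, y.1 = x.1 ++ [j] → s(x, y) ≠ s(u, v) →
        (v.1 <+: x.1 ↔ v.1 <+: y.1) := by
      intro x y j hxy hne
      rw [hxy, List.prefix_concat_iff]
      refine ⟨Or.inr, fun h => h.resolve_left fun h => hne ?_⟩
      have hyv : v = y := Subtype.ext (h.trans hxy.symm)
      rw [huv] at h
      have hxu : u = x := Subtype.ext (List.append_inj' h rfl).1
      rw [hxu, hyv]
    have inv : ∀ {x y : t.Vertex}, (t.graph.deleteEdges {s(u, v)}).Walk x y →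
        (v.1 <+: x.1 ↔ v.1 <+: y.1) := by
      intro x y w
      induction w with
      | nil => rfl
      | cons h _ ih =>
        rw [← ih]
        rw [SimpleGraph.deleteEdges_adj] at h
        obtain ⟨⟨j, h1 | h1⟩, h2⟩ := h
        · exact step _ _ j h1 (by simpa using h2)
        · exact (step _ _ j h1 (by rw [Sym2.eq_swap]; simpa using h2)).symm
    have h := (inv w).2 (List.prefix_refl _)
    rw [huv] at h
    simpa using h.length_le
  rw [SimpleGraph.isAcyclic_iff_forall_adj_isBridge]
  rintro u v ⟨i, h | h⟩
  · exact key u v i h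
  · rw [Sym2.eq_swap]; exact key v u i h

/-- In a connected subgraph, every vertex descends within the subgraph from the vertex closest to
the root. -/
theorem exists_top_of_connected {t : OrderedTree} (H : t.graph.Subgraph) (hH : H.coe.Connected) :
    ∃ p ∈ H.verts, ∀ v ∈ H.verts, p.1 <+: v.1 ∧
      ∀ (x y : t.Vertex) (i : ℕ), y.1 = x.1 ++ [i] → y.1 <+: v.1 → p.1 <+: y.1 → p ≠ y →
        H.Adj x y := by
  have hne : (Set.range fun v : H.verts => v.1.1.length).Nonempty := by
    obtain ⟨v⟩ := hH.nonempty
    exact ⟨_, v, rfl⟩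
  obtain ⟨p, hp⟩ := Nat.sInf_mem hne
  have hmin : ∀ v ∈ H.verts, p.1.1.length ≤ v.1.length := by
    intro v hv
    have : p.1.1.length = sInf (Set.range fun v : H.verts => v.1.1.length) := hp
    rw [this]
    exact Nat.sInf_le ⟨⟨v, hv⟩, rfl⟩
  refine ⟨p.1, p.2, ?_⟩
  let R : t.Vertex → Prop := fun v => p.1.1 <+: v.1 ∧
      ∀ (x y : t.Vertex) (i : ℕ), y.1 = x.1 ++ [i] → y.1 <+: v.1 → p.1.1 <+: y.1 → p.1 ≠ y →
        H.Adj x y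
  have step : ∀ u v : t.Vertex, H.Adj u v → R u → R v := by
    rintro u v huv ⟨h1, h2⟩
    obtain ⟨i, h | h⟩ := H.adj_sub huv
    · refine ⟨h ▸ h1.trans (List.prefix_append _ _), ?_⟩
      intro x y j hxy hyv hpy hne
      rw [h, List.prefix_concat_iff] at hyv
      rcases hyv with hyv | hyv
      · have hy : y = v := Subtype.ext (hyv.trans h.symm)
        rw [hxy] at hyv
        have hx : x = u := Subtype.ext (List.append_inj' hyv rfl).1
        rwa [hx, hy]
      · exact h2 x y j hxy hyv hpy hne
    · have hv := hmin v (H.edge_vert huv.symm)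
      have h1' := h1
      rw [h, List.prefix_concat_iff] at h1'
      rcases h1' with h1' | h1'
      · have := congrArg List.length h1'
        simp at this
        omega
      · refine ⟨h1', fun x y j hxy hyv hpy hne => h2 x y j hxy ?_ hpy hne⟩
        rw [h]
        exact hyv.trans (List.prefix_append _ _)
  have all : ∀ {u v : H.verts}, H.coe.Walk u v → R u → R v := by
    intro u v w
    induction w with
    | nil => exact id
    | cons h _ ih => exact fun hu => ih (step _ _ h hu)
  have hRp : R p := by
    refine ⟨List.prefix_refl _, fun x y i _ h1 h2 hne => absurd ?_ hne⟩
    exact Subtype.ext (h2.eq_of_length_le h1.length_le)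
  intro v hv
  obtain ⟨w⟩ := hH.preconnected p ⟨v, hv⟩
  exact all w hRp

theorem isSubtreeAt_verts {t : OrderedTree} (H : t.graph.Subgraph) (hH : H.coe.Connected) :
    ∃ p, IsSubtreeAt t p (Subtype.val '' H.verts) := by
  obtain ⟨p, hp, h⟩ := exists_top_of_connected H hH
  refine ⟨p.1, ?_, ⟨p, hp, rfl⟩, ?_, ?_⟩
  · rintro _ ⟨v, _, rfl⟩
    exact v.2
  · rintro _ ⟨v, hv, rfl⟩
    exact (h v hv).1
  · rintro v i ⟨y, hy, hyv⟩ hne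
    have hv : IsVertex v t := isVertex_of_append v [i] t (hyv ▸ y.2)
    exact ⟨⟨v, hv⟩, H.edge_vert ((h y hy).2 ⟨v, hv⟩ y i hyv (List.prefix_refl _) (h y hy).1
      (by rintro rfl; exact hne hyv.symm)), rfl⟩

/-- A connected subgraph of a tree is determined by its vertices. -/
theorem eq_of_verts_eq {t : OrderedTree} {H H' : t.graph.Subgraph} (hH : H.coe.Connected)
    (hH' : H'.coe.Connected) (h : H.verts = H'.verts) : H = H' := by
  have key : ∀ K K' : t.graph.Subgraph, K.coe.Connected → K.verts = K'.verts →
      ∀ u v i, v.1 = u.1 ++ [i] → K'.Adj u v → K.Adj u v := by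
    intro K K' hK hKK u v i huv hadj
    obtain ⟨p, hp, hp'⟩ := exists_top_of_connected K hK
    have hu : u ∈ K.verts := hKK ▸ K'.edge_vert hadj
    have hv : v ∈ K.verts := hKK ▸ K'.edge_vert hadj.symm
    refine (hp' v hv).2 u v i huv (List.prefix_refl _) (hp' v hv).1 ?_
    rintro rfl
    have := (hp' u hu).1.length_le
    rw [huv] at this
    simp at this
  have key2 : ∀ K K' : t.graph.Subgraph, K.coe.Connected → K.verts = K'.verts →
      ∀ u v, K'.Adj u v → K.Adj u v := by
    intro K K' hK hKK u v hadj
    obtain ⟨i, h | h⟩ := K'.adj_sub hadj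
    · exact key K K' hK hKK u v i h hadj
    · exact (key K K' hK hKK v u i h hadj.symm).symm
  refine SimpleGraph.Subgraph.ext h ?_
  funext u v
  exact propext ⟨key2 H' H hH' h.symm u v, key2 H H' hH h u v⟩

theorem connected_induce_of_isSubtreeAt {t : OrderedTree} {p : List ℕ} {s : Set (List ℕ)}
    (hs : IsSubtreeAt t p s) :
    ((⊤ : t.graph.Subgraph).induce {v | v.1 ∈ s}).coe.Connected := by
  obtain ⟨h1, hp, h2, h3⟩ := hs
  set H := (⊤ : t.graph.Subgraph).induce {v | v.1 ∈ s}
  have hpH : (⟨p, h1 p hp⟩ : t.Vertex) ∈ H.verts := hp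
  have reach : ∀ v : List ℕ, ∀ hv : v ∈ s,
      H.coe.Reachable ⟨⟨p, h1 p hp⟩, hpH⟩ ⟨⟨v, h1 v hv⟩, hv⟩ := by
    intro v
    induction v using List.reverseRecOn with
    | nil =>
      intro hv
      have : p = [] := List.prefix_nil.1 (h2 _ hv)
      subst this
      exact SimpleGraph.Reachable.refl _
    | append_singleton v i ih =>
      intro hv
      by_cases hvp : v ++ [i] = p
      · subst hvp
        exact SimpleGraph.Reachable.refl _
      · have hv' := h3 v i hv hvp
        refine (ih hv').trans (SimpleGraph.Adj.reachable ?_)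
        simp only [SimpleGraph.Subgraph.coe_adj, H]
        exact ⟨hv', hv, ⟨i, Or.inl rfl⟩⟩
  have : Nonempty H.verts := ⟨⟨_, hpH⟩⟩
  refine ⟨fun u v => ?_⟩
  exact (reach u.1.1 u.2).symm.trans (reach v.1.1 v.2)

theorem rhoIndex_eq_card (t : OrderedTree) :
    t.rhoIndex = Nat.card {s // ∃ p, IsSubtreeAt t p s} := by
  refine Nat.card_eq_of_bijective
    (fun H => ⟨Subtype.val '' H.1.verts, isSubtreeAt_verts H.1 H.2.connected⟩) ⟨?_, ?_⟩
  · intro H H' h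
    exact Subtype.ext (eq_of_verts_eq H.2.connected H'.2.connected
      (Subtype.val_injective.image_injective (congrArg Subtype.val h)))
  · rintro ⟨s, p, hs⟩
    refine ⟨⟨(⊤ : t.graph.Subgraph).induce {v | v.1 ∈ s},
      ⟨connected_induce_of_isSubtreeAt hs, (graph_isAcyclic t).subgraph _⟩⟩, ?_⟩
    apply Subtype.ext
    ext v
    exact ⟨by rintro ⟨w, hw, rfl⟩; exact hw, fun hv => ⟨⟨v, hs.1 v hv⟩, hv, rfl⟩⟩

theorem isSubtreeAt_cons_iff {l : List OrderedTree} {i : ℕ} (hi : i < l.length) {p : List ℕ}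
    {s : Set (List ℕ)} :
    IsSubtreeAt (node l) (i :: p) s ↔
      IsSubtreeAt l[i] p {v | i :: v ∈ s} ∧ ∀ v ∈ s, ∃ w, v = i :: w := by
  constructor
  · rintro ⟨h1, hp, h2, h3⟩
    refine ⟨⟨fun v hv => (h1 _ hv).2, hp, fun v hv => ?_, fun v j hv hne => ?_⟩, ?_⟩
    · simpa using h2 _ hv
    · exact h3 (i :: v) j hv (by simpa using hne)
    · intro v hv
      obtain ⟨w, rfl⟩ := h2 v hv
      exact ⟨p ++ w, rfl⟩
  · rintro ⟨⟨h1, hp, h2, h3⟩, h4⟩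
    refine ⟨?_, hp, ?_, ?_⟩
    · intro v hv
      obtain ⟨w, rfl⟩ := h4 v hv
      exact ⟨hi, h1 w hv⟩
    · intro v hv
      obtain ⟨w, rfl⟩ := h4 v hv
      simpa using h2 w hv
    · rintro (_ | ⟨k, v⟩) j hv hne
      · obtain ⟨w, hw⟩ := h4 _ hv
        simp only [List.nil_append, List.cons.injEq] at hw
        obtain ⟨rfl, rfl⟩ := hw
        have : p = [] := List.prefix_nil.1 (h2 [] hv)
        simp [this] at hne
      · obtain ⟨w, hw⟩ := h4 _ hv
        simp only [List.cons_append, List.cons.injEq] at hw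
        obtain ⟨rfl, rfl⟩ := hw
        exact h3 v j hv (by simpa using hne)

theorem rhoIndex_node (l : List OrderedTree) :
    (node l).rhoIndex = (node l).rootedRho + (l.map rhoIndex).sum := by
  rw [rhoIndex_eq_card, card_eq_add_card (t := node l) (fun s hs => hs.choose_spec.1), add_comm,
    ← Fin.sum_univ_fun_getElem]
  congr 1
  · rw [rootedRho]
    refine Nat.card_congr (Equiv.subtypeEquivRight fun s => and_congr_left fun h0 => ?_)
    constructor
    · rintro ⟨p, h1, hp, h2, h3⟩
      have : p = [] := List.prefix_nil.1 (h2 [] h0)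
      subst this
      exact ⟨h1, fun v i hv => h3 v i hv (by simp)⟩
    · rintro ⟨h1, h2⟩
      exact ⟨[], h1, h0, fun _ _ => List.nil_prefix, fun v i hv _ => h2 v i hv⟩
  · have : ∀ i : Fin l.length, Finite {s // ∃ p, IsSubtreeAt l[i] p s} := fun i =>
      finite_sets_of_vertices fun s hs => hs.choose_spec.1
    have hsum : ∑ i : Fin l.length, rhoIndex l[i.1] =
        Nat.card (Σ i : Fin l.length, {s // ∃ p, IsSubtreeAt l[i] p s}) := by
      rw [Nat.card_sigma]
      simp only [rhoIndex_eq_card]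
      rfl
    have trace : ∀ (i : ℕ) (s : Set (List ℕ)), {v | i :: v ∈ (i :: ·) '' s} = s := by
      intro i s
      ext v
      simp
    have cons_mem : ∀ x : Σ i : Fin l.length, {s // ∃ p, IsSubtreeAt l[i] p s},
        ∃ p, IsSubtreeAt (node l) p ((x.1.1 :: ·) '' x.2.1) := by
      rintro ⟨i, s, p, hp⟩
      refine ⟨i.1 :: p, (isSubtreeAt_cons_iff i.2).2 ⟨?_, ?_⟩⟩
      · rw [trace]; exact hp
      · rintro _ ⟨w, _, rfl⟩
        exact ⟨w, rfl⟩
    rw [hsum]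
    refine (Nat.card_eq_of_bijective (fun x => ⟨(x.1.1 :: ·) '' x.2.1, cons_mem x, by simp⟩)
      ⟨?_, ?_⟩).symm
    · rintro ⟨i, s, p, hp⟩ ⟨i', s', p', hp'⟩ h
      have h' : (i.1 :: ·) '' s = (i'.1 :: ·) '' s' := congrArg Subtype.val h
      have hmem : i.1 :: p ∈ (i'.1 :: ·) '' s' := h' ▸ ⟨p, hp.2.1, rfl⟩
      obtain ⟨w, _, hw⟩ := hmem
      simp only [List.cons.injEq] at hw
      obtain rfl : i' = i := Fin.ext hw.1
      have : s = s' := by rw [← trace i'.1 s, h', trace]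
      subst this
      rfl
    · rintro ⟨s, ⟨p, hp⟩, h0⟩
      rcases p with _ | ⟨i, p⟩
      · exact absurd hp.2.1 h0
      · have hi : i < l.length := (hp.1 _ hp.2.1).1
        have h := (isSubtreeAt_cons_iff hi).1 hp
        refine ⟨⟨⟨i, hi⟩, _, p, h.1⟩, Subtype.ext ?_⟩
        ext v
        constructor
        · rintro ⟨w, hw, rfl⟩
          exact hw
        · intro hv
          obtain ⟨w, rfl⟩ := h.2 v hv
          exact ⟨w, hv, rfl⟩

end OrderedTree

/-! ### Sums over lists and over trees -/

theorem tsum_pi_prod_eq_pow {α : Type*} (f : α → ℝ≥0∞) (n : ℕ) :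
    ∑' v : Fin n → α, ∏ i, f (v i) = (∑' a, f a) ^ n := by
  induction n with
  | zero => simp [tsum_fintype]
  | succ n ih =>
    rw [← (Fin.consEquiv fun _ : Fin (n + 1) => α).tsum_eq, ENNReal.tsum_prod', pow_succ', ← ih,
      ← ENNReal.tsum_mul_right]
    refine tsum_congr fun a => ?_
    rw [← ENNReal.tsum_mul_left]
    refine tsum_congr fun v => ?_
    simp [Fin.consEquiv, Fin.prod_univ_succ]

theorem tsum_list_prod_map {α : Type*} (f : α → ℝ≥0∞) :
    ∑' l : List α, (l.map f).prod = (1 - ∑' a, f a)⁻¹ := by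
  rw [← ENNReal.tsum_geometric, ← List.equivSigmaTuple.symm.tsum_eq, ENNReal.tsum_sigma']
  refine tsum_congr fun n => ?_
  rw [← tsum_pi_prod_eq_pow]
  refine tsum_congr fun v => ?_
  simp [List.equivSigmaTuple, List.map_ofFn, List.prod_ofFn]

theorem summable_norm_list_prod_map {α : Type*} {f : α → ℂ} (hf : Summable fun a => ‖f a‖)
    (h1 : ∑' a, ‖f a‖ < 1) : Summable fun l : List α => ‖(l.map f).prod‖ := by
  have hnn : ∀ l : List α, ENNReal.ofReal ‖(l.map f).prod‖
      = (l.map fun a => ENNReal.ofReal ‖f a‖).prod := by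
    intro l
    induction l with
    | nil => simp
    | cons a l ih =>
      rw [List.map_cons, List.prod_cons, norm_mul, ENNReal.ofReal_mul (norm_nonneg _), ih,
        List.map_cons, List.prod_cons]
  have h2 : ∑' l : List α, ENNReal.ofReal ‖(l.map f).prod‖ ≠ ∞ := by
    simp only [hnn, tsum_list_prod_map]
    rw [← ENNReal.ofReal_tsum_of_nonneg (fun _ => norm_nonneg _) hf, ENNReal.inv_ne_top]
    exact (tsub_pos_of_lt (ENNReal.ofReal_lt_one.2 h1)).ne'
  have h3 := ENNReal.summable_toReal h2
  exact h3.congr fun l => ENNReal.toReal_ofReal (norm_nonneg _)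

/-- A nonempty list consists of a head and a tail. -/
def prodListEquiv (α : Type*) : α × List α ≃ {l : List α // l ∉ ({[]} : Finset (List α))} where
  toFun x := ⟨x.1 :: x.2, by simp⟩
  invFun
    | ⟨[], h⟩ => absurd (Finset.mem_singleton_self _) h
    | ⟨a :: l, _⟩ => (a, l)
  left_inv _ := rfl
  right_inv := by
    rintro ⟨_ | ⟨a, l⟩, h⟩
    · exact absurd (Finset.mem_singleton_self _) h
    · rfl

theorem tsum_list {α : Type*} {F : List α → ℂ} (hF : Summable F) :
    ∑' l, F l = F [] + ∑' x : α × List α, F (x.1 :: x.2) := by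
  rw [← hF.sum_add_tsum_subtype_compl {[]}, Finset.sum_singleton,
    ← (prodListEquiv α).tsum_eq]
  rfl

theorem tsum_list_prod_mul_one_sub {α : Type*} {f : α → ℂ} (hf : Summable fun a => ‖f a‖)
    (h1 : ∑' a, ‖f a‖ < 1) : (∑' l : List α, (l.map f).prod) * (1 - ∑' a, f a) = 1 := by
  have h2 := summable_norm_list_prod_map hf h1
  have h3 := tsum_list h2.of_norm
  simp only [List.map_nil, List.prod_nil, List.map_cons, List.prod_cons] at h3
  rw [← tsum_mul_tsum_of_summable_norm hf h2] at h3
  linear_combination h3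

/-- The sum over all lists of a product in which one factor is marked by an additive weight. -/
theorem tsum_list_prod_mul_sum {α : Type*} {f g : α → ℂ} (hf : Summable fun a => ‖f a‖)
    (h1 : ∑' a, ‖f a‖ < 1) (hg : Summable fun a => ‖f a * g a‖)
    (h : Summable fun l : List α => ‖(l.map f).prod * (l.map g).sum‖) :
    (∑' l : List α, (l.map f).prod * (l.map g).sum) * (1 - ∑' a, f a) =
      (∑' a, f a * g a) * ∑' l : List α, (l.map f).prod := by
  have h2 := summable_norm_list_prod_map hf h1
  have h3 := tsum_list h.of_norm
  simp only [List.map_nil, List.prod_nil, List.map_cons, List.prod_cons, List.sum_nil,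
    List.sum_cons, mul_zero, zero_add] at h3
  have h4 : ∀ x : α × List α, f x.1 * (x.2.map f).prod * (g x.1 + (x.2.map g).sum) =
      f x.1 * g x.1 * (x.2.map f).prod + f x.1 * ((x.2.map f).prod * (x.2.map g).sum) := by
    intro x; ring
  simp only [h4] at h3
  rw [Summable.tsum_add (summable_mul_of_summable_norm hg h2) (summable_mul_of_summable_norm hf h),
    ← tsum_mul_tsum_of_summable_norm hf h, ← tsum_mul_tsum_of_summable_norm hg h2] at h3
  linear_combination h3

namespace OrderedTree

/-- A tree is the list of its branches. -/
def nodeEquiv : List OrderedTree ≃ OrderedTree where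
  toFun := node
  invFun := branches
  left_inv _ := rfl
  right_inv := by rintro ⟨_⟩; rfl

theorem sum_map_order_le_iff {l : List OrderedTree} {h : ℕ} (hl : (node l).order ≤ h + 1) :
    ∀ t ∈ l, t.order ≤ h := by
  intro t ht
  rw [order_node] at hl
  have := List.single_le_sum (l := l.map order) (fun _ _ => Nat.zero_le _) t.order
    (List.mem_map_of_mem ht)
  omega

/-- The sum of the weights of the trees with at most `h` vertices. -/
noncomputable def truncSum (w : OrderedTree → ℝ≥0∞) (h : ℕ) : ℝ≥0∞ :=
  ∑' t : OrderedTree, if t.order ≤ h then w t else 0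

theorem truncSum_zero (w : OrderedTree → ℝ≥0∞) : truncSum w 0 = 0 := by
  simp [truncSum, (order_pos _).ne']

theorem truncSum_add (w w' : OrderedTree → ℝ≥0∞) (h : ℕ) :
    truncSum (fun t => w t + w' t) h = truncSum w h + truncSum w' h := by
  rw [truncSum, truncSum, truncSum, ← ENNReal.tsum_add]
  refine tsum_congr fun t => ?_
  split_ifs <;> simp

/-- If the weight of a tree is `x` times the product of the weights of its branches, then the sum
over the trees with at most `h + 1` vertices is bounded by a geometric series. -/
theorem truncSum_succ_le {x : ℝ≥0∞} {w f : OrderedTree → ℝ≥0∞}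
    (hw : ∀ l, w (node l) = x * (l.map f).prod) (h : ℕ) :
    truncSum w (h + 1) ≤ x * (1 - truncSum f h)⁻¹ := by
  rw [truncSum, truncSum, ← tsum_list_prod_map, ← ENNReal.tsum_mul_left, ← nodeEquiv.tsum_eq]
  refine ENNReal.tsum_le_tsum fun l => ?_
  change (if (node l).order ≤ h + 1 then w (node l) else 0) ≤ _
  split_ifs with hl
  · rw [hw]
    refine le_of_eq (congrArg _ (congrArg _ (List.map_congr_left fun t ht => ?_)))
    rw [if_pos (sum_map_order_le_iff hl t ht)]
  · exact zero_le

theorem tsum_le_of_truncSum_le {w : OrderedTree → ℝ≥0∞} {b : ℝ≥0∞} (h : ∀ n, truncSum w n ≤ b) :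
    ∑' t, w t ≤ b := by
  rw [ENNReal.tsum_eq_iSup_sum]
  refine iSup_le fun s => le_trans ?_ (h (s.sup order))
  refine le_trans (le_of_eq ?_) (ENNReal.sum_le_tsum s)
  exact Finset.sum_congr rfl fun t ht => (if_pos (Finset.le_sup (f := order) ht)).symm

/-! ### The number of ordered trees -/

/-- A tree that is not a single vertex consists of its first branch and of the tree that remains
when this branch is removed. -/
def firstBranchEquiv : OrderedTree × OrderedTree ≃ {t : OrderedTree // t.branches ≠ []} where
  toFun x := ⟨node (x.1 :: x.2.branches), by simp [branches]⟩
  invFun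
    | ⟨node (t :: l), _⟩ => (t, node l)
    | ⟨node [], h⟩ => absurd rfl h
  left_inv := by rintro ⟨t, ⟨l⟩⟩; rfl
  right_inv := by
    rintro ⟨⟨_ | ⟨t, l⟩⟩, h⟩
    · exact absurd rfl h
    · rfl

theorem mem_treesOfOrder {n : ℕ} {t : OrderedTree} : t ∈ treesOfOrder n ↔ t.order = n := by
  simp [treesOfOrder]

theorem card_treesOfOrder_succ (n : ℕ) : (treesOfOrder (n + 1)).card = catalan n := by
  classical
  induction n using Nat.strong_induction_on with
  | _ n ih =>
    rcases n with _ | n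
    · rw [catalan_zero, Finset.card_eq_one]
      refine ⟨node [], ?_⟩
      ext ⟨l⟩
      rw [mem_treesOfOrder, Finset.mem_singleton, order_node]
      rcases l with _ | ⟨t, l⟩
      · simp
      · have := order_pos t
        simp
        omega
    · have : treesOfOrder (n + 1 + 1) = (Finset.HasAntidiagonal.antidiagonal n).biUnion fun p =>
          ((treesOfOrder (p.1 + 1)) ×ˢ (treesOfOrder (p.2 + 1))).image
            fun x => (firstBranchEquiv x).1 := by
        ext t
        simp only [mem_treesOfOrder, Finset.mem_biUnion, Finset.HasAntidiagonal.mem_antidiagonal,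
          Finset.mem_image, Finset.mem_product]
        constructor
        · intro ht
          rcases t with ⟨_ | ⟨t, l⟩⟩
          · simp [order_node] at ht
          · have h1 := order_pos t
            have h2 := order_pos (node l)
            simp only [order_node, List.map_cons, List.sum_cons] at ht h2
            refine ⟨(t.order - 1, (node l).order - 1), ?_, (t, node l), ⟨?_, ?_⟩, rfl⟩ <;>
              simp only [order_node] <;> omega
        · rintro ⟨⟨i, j⟩, hij, ⟨t, ⟨l⟩⟩, ⟨h1, h2⟩, rfl⟩
          simp only [order_node] at h1 h2 hij
          change (node (t :: l)).order = _
          simp only [order_node, List.map_cons, List.sum_cons]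
          omega
      rw [this, Finset.card_biUnion, catalan_succ']
      · refine Finset.sum_congr rfl fun p hp => ?_
        have hp' := Finset.HasAntidiagonal.mem_antidiagonal.1 hp
        have hinj : Function.Injective fun x => (firstBranchEquiv x).1 :=
          Subtype.val_injective.comp firstBranchEquiv.injective
        rw [Finset.card_image_of_injective _ hinj, Finset.card_product,
          ih p.1 (by omega), ih p.2 (by omega)]
      · intro p _ q _ hpq
        rw [Function.onFun, Finset.disjoint_left]
        simp only [Finset.mem_image, Finset.mem_product, mem_treesOfOrder]
        rintro _ ⟨x, ⟨h1, h2⟩, rfl⟩ ⟨y, ⟨h3, h4⟩, hxy⟩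
        obtain rfl := firstBranchEquiv.injective (Subtype.ext hxy)
        exact hpq (Prod.ext (by omega) (by omega))

end OrderedTree

/-! ### Generating functions of tree parameters -/

namespace OrderedTree

/-- The generating function `∑ c(t) z^|t|` of a tree parameter `c`. -/
noncomputable def genFun (c : OrderedTree → ℕ) (z : ℂ) : ℂ := ∑' t, (c t : ℂ) * z ^ t.order

/-- The generating function of `c` converges absolutely on the closed disc of radius `x`. -/
def ConvergesAt (c : OrderedTree → ℕ) (x : ℝ) : Prop :=
  Summable fun t => (c t : ℝ) * x ^ t.order

theorem node_term {R : Type*} [CommSemiring R] {c f : OrderedTree → ℕ} {l : List OrderedTree}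
    (h : c (node l) = (l.map f).prod) (z : R) :
    (c (node l) : R) * z ^ (node l).order =
      z * (l.map fun t => (f t : R) * z ^ t.order).prod := by
  rw [h, order_node, pow_add, pow_one]
  have : (l.map fun t => (f t : R) * z ^ t.order).prod =
      ((l.map f).prod : ℕ) * z ^ (l.map order).sum := by
    clear h
    induction l with
    | nil => simp
    | cons t l ih =>
      simp only [List.map_cons, List.prod_cons, List.sum_cons, ih, Nat.cast_mul, pow_add]
      ring
  rw [this]
  ring

section Convergence

variable {c d : OrderedTree → ℕ} {x : ℝ}

theorem norm_term_le (_ : 0 ≤ x) {z : ℂ} (hz : ‖z‖ ≤ x) (t : OrderedTree) :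
    ‖(c t : ℂ) * z ^ t.order‖ ≤ (c t : ℝ) * x ^ t.order := by
  rw [norm_mul, norm_pow, Complex.norm_natCast]
  gcongr

theorem ConvergesAt.summable_norm (h : ConvergesAt c x) (hx : 0 ≤ x) {z : ℂ} (hz : ‖z‖ ≤ x) :
    Summable fun t => ‖(c t : ℂ) * z ^ t.order‖ :=
  h.of_nonneg_of_le (fun _ => norm_nonneg _) (norm_term_le hx hz)

theorem ConvergesAt.tsum_norm_le (h : ConvergesAt c x) (hx : 0 ≤ x) {z : ℂ} (hz : ‖z‖ ≤ x) :
    ∑' t, ‖(c t : ℂ) * z ^ t.order‖ ≤ ∑' t, (c t : ℝ) * x ^ t.order :=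
  (h.summable_norm hx hz).tsum_le_tsum (norm_term_le hx hz) h

theorem ConvergesAt.norm_genFun_le (h : ConvergesAt c x) (hx : 0 ≤ x) {z : ℂ} (hz : ‖z‖ ≤ x) :
    ‖genFun c z‖ ≤ ∑' t, (c t : ℝ) * x ^ t.order :=
  (norm_tsum_le_tsum_norm (h.summable_norm hx hz)).trans (h.tsum_norm_le hx hz)

theorem ConvergesAt.continuousOn (h : ConvergesAt c x) (hx : 0 ≤ x) :
    ContinuousOn (genFun c) (Metric.closedBall 0 x) :=
  continuousOn_tsum (fun t => by fun_prop) h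
    fun t z hz => norm_term_le hx (by simpa using hz) t

theorem ConvergesAt.analyticOnNhd (h : ConvergesAt c x) (hx : 0 ≤ x) :
    AnalyticOnNhd ℂ (genFun c) (Metric.ball 0 x) := by
  refine DifferentiableOn.analyticOnNhd ?_ Metric.isOpen_ball
  refine Complex.differentiableOn_tsum_of_summable_norm h (fun t => by fun_prop)
    Metric.isOpen_ball fun t z hz => norm_term_le hx ?_ t
  exact (by simpa using hz : ‖z‖ < x).le

theorem ConvergesAt.mono (h : ConvergesAt c x) (_ : 0 ≤ x) (hd : ∀ t, d t ≤ c t) :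
    ConvergesAt d x :=
  h.of_nonneg_of_le (fun _ => by positivity) fun t => by gcongr; exact hd t

theorem genFun_add {z : ℂ} (hc : Summable fun t => ‖(c t : ℂ) * z ^ t.order‖)
    (hd : Summable fun t => ‖(d t : ℂ) * z ^ t.order‖) :
    genFun (fun t => c t + d t) z = genFun c z + genFun d z := by
  rw [genFun, genFun, genFun, ← hc.of_norm.tsum_add hd.of_norm]
  exact tsum_congr fun t => by push_cast; ring

theorem ConvergesAt.add (hc : ConvergesAt c x) (hd : ConvergesAt d x) :
    ConvergesAt (fun t => c t + d t) x :=
  (Summable.add hc hd).congr fun t => by push_cast; ring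

/-- The functional equation of the generating function of a parameter that is the product of the
values of another parameter at the branches. -/
theorem genFun_mul_one_sub (hc : ∀ l, c (node l) = (l.map d).prod) (hx : 0 ≤ x)
    (hd : ConvergesAt d x) (h1 : ∑' t, (d t : ℝ) * x ^ t.order < 1) {z : ℂ} (hz : ‖z‖ ≤ x) :
    genFun c z * (1 - genFun d z) = z := by
  have h := tsum_list_prod_mul_one_sub (hd.summable_norm hx hz)
    ((hd.tsum_norm_le hx hz).trans_lt h1)
  have h' : genFun c z = z * ∑' l : List OrderedTree,
      (l.map fun t => (d t : ℂ) * z ^ t.order).prod := by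
    rw [genFun, ← nodeEquiv.tsum_eq, ← tsum_mul_left]
    exact tsum_congr fun l => node_term (hc l) z
  rw [h', mul_assoc]
  unfold genFun
  rw [h, mul_one]

/-- The functional equation for a parameter of the form `c ρ` with `c` as above and `ρ` the sum of
`r` and of an additive functional of the branches. -/
theorem genFun_marked (r ρ : OrderedTree → ℕ) (hc : ∀ l, c (node l) = (l.map d).prod)
    (hρ : ∀ l, ρ (node l) = r (node l) + (l.map ρ).sum) (hx : 0 < x)
    (hd : ConvergesAt d x) (h1 : ∑' t, (d t : ℝ) * x ^ t.order < 1) {z : ℂ} (hz : ‖z‖ ≤ x)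
    (hz0 : z ≠ 0)
    (hdr : Summable fun t => ‖((d t * ρ t : ℕ) : ℂ) * z ^ t.order‖)
    (hcr : Summable fun t => ‖((c t * ρ t : ℕ) : ℂ) * z ^ t.order‖)
    (hcr' : Summable fun t => ‖((c t * r t : ℕ) : ℂ) * z ^ t.order‖) :
    (genFun (fun t => c t * ρ t) z - genFun (fun t => c t * r t) z) * (1 - genFun d z) ^ 2 =
      z * genFun (fun t => d t * ρ t) z := by
  set f : OrderedTree → ℂ := fun t => (d t : ℂ) * z ^ t.order
  set g : OrderedTree → ℂ := fun t => (ρ t : ℂ)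
  have hf : Summable fun t => ‖f t‖ := hd.summable_norm hx.le hz
  have hf1 : ∑' t, ‖f t‖ < 1 := (hd.tsum_norm_le hx.le hz).trans_lt h1
  have hfg : ∀ t, f t * g t = ((d t * ρ t : ℕ) : ℂ) * z ^ t.order := fun t => by
    simp only [f, g]; push_cast; ring
  have hterm : ∀ l : List OrderedTree, z * ((l.map f).prod * (l.map g).sum) =
      ((c (node l) * ρ (node l) : ℕ) : ℂ) * z ^ (node l).order -
        ((c (node l) * r (node l) : ℕ) : ℂ) * z ^ (node l).order := by
    intro l
    have h2 := node_term (hc l) z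
    have h3 : (l.map g).sum = ((l.map ρ).sum : ℕ) := by
      rw [Nat.cast_list_sum, List.map_map]; rfl
    rw [h3, ← mul_assoc, ← h2, hρ]
    push_cast
    ring
  have hsub : Summable fun l : List OrderedTree => ‖z * ((l.map f).prod * (l.map g).sum)‖ := by
    simp only [hterm]
    exact Summable.of_nonneg_of_le (fun _ => norm_nonneg _) (fun l => norm_sub_le _ _)
      ((nodeEquiv.summable_iff.2 hcr).add (nodeEquiv.summable_iff.2 hcr'))
  have hlist : Summable fun l : List OrderedTree => ‖(l.map f).prod * (l.map g).sum‖ := by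
    simp only [norm_mul z] at hsub
    exact (summable_mul_left_iff (norm_ne_zero_iff.2 hz0)).1 hsub
  have h4 := tsum_list_prod_mul_sum hf hf1 (by simpa only [hfg] using hdr) hlist
  have h5 := tsum_list_prod_mul_one_sub hf hf1
  have h6 : genFun (fun t => c t * ρ t) z - genFun (fun t => c t * r t) z =
      z * ∑' l : List OrderedTree, (l.map f).prod * (l.map g).sum := by
    rw [genFun, genFun, ← hcr.of_norm.tsum_sub hcr'.of_norm, ← nodeEquiv.tsum_eq,
      ← tsum_mul_left]
    exact tsum_congr fun l => (hterm l).symm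
  have h7 : genFun (fun t => d t * ρ t) z = ∑' t, f t * g t := tsum_congr fun t => (hfg t).symm
  have h8 : genFun d z = ∑' t, f t := rfl
  rw [h6, h7, h8]
  -- `h4` is `D (1 - F) = K L` and `h5` is `L (1 - F) = 1`, so that `D (1 - F)² = K`
  linear_combination z * (1 - ∑' t, f t) * h4 + z * (∑' t, f t * g t) * h5

end Convergence

theorem sigmaOut_mul_rootedRho_node (l : List OrderedTree) :
    (node l).sigmaOut * (node l).rootedRho =
      (l.map fun t => t.sigmaIndex * (1 + t.rootedRho)).prod := by
  rw [sigmaOut_node, rootedRho_node, List.prod_map_mul]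

theorem sigmaIn_mul_rootedRho_node (l : List OrderedTree) :
    (node l).sigmaIn * (node l).rootedRho =
      (l.map fun t => t.sigmaOut * (1 + t.rootedRho)).prod := by
  rw [sigmaIn_node, rootedRho_node, List.prod_map_mul]

theorem rootedRho_le_of_mem {l : List OrderedTree} {t : OrderedTree} (ht : t ∈ l) :
    t.rootedRho ≤ (node l).rootedRho := by
  rw [rootedRho_node]
  have h : 1 + t.rootedRho ∣ (l.map fun t => 1 + t.rootedRho).prod :=
    List.dvd_prod (List.mem_map_of_mem ht)
  have hpos : 0 < (l.map fun t => 1 + t.rootedRho).prod := by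
    refine Nat.pos_of_ne_zero fun h0 => ?_
    obtain ⟨s, _, hs⟩ := List.mem_map.1 (List.prod_eq_zero_iff.1 h0)
    omega
  have := Nat.le_of_dvd hpos h
  omega

/-- For each vertex there are at most `rootedRho` subtrees whose vertex closest to the root is the
given one: adding the path to the root embeds them into the subtrees containing the root. -/
theorem rhoIndex_le (t : OrderedTree) : t.rhoIndex ≤ t.order * t.rootedRho := by
  induction t using branchInduction with
  | h l ih =>
    rw [rhoIndex_node, order_node, add_mul, one_mul]
    gcongr
    rw [← List.sum_map_mul_right]
    refine List.sum_le_sum fun t ht => (ih t ht).trans ?_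
    gcongr
    exact rootedRho_le_of_mem ht

end OrderedTree

/-! ### The critical values -/

theorem exists_critical_root :
    ∃ v : ℝ, 0.31110781746 ≤ v ∧ v ≤ 0.31110781747 ∧ v ^ 3 - v ^ 2 - 3 * v + 1 = 0 := by
  have h := intermediate_value_Icc' (a := (0.31110781746 : ℝ)) (b := 0.31110781747) (by norm_num)
    (f := fun v : ℝ => v ^ 3 - v ^ 2 - 3 * v + 1) (by fun_prop)
  obtain ⟨v, hv, h0⟩ := h (show (0 : ℝ) ∈ _ from ⟨by norm_num, by norm_num⟩)
  exact ⟨v, hv.1, hv.2, h0⟩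

/-- The smallest positive critical point of the rational function `v (1 - v)² / (1 + v - v²)`. -/
noncomputable def critV : ℝ := exists_critical_root.choose

/-- The value of `v (1 - v)² / (1 + v - v²)` at the critical point, reduced modulo the minimal
polynomial of `critV`. -/
noncomputable def critY : ℝ := (3 - 8 * critV + critV ^ 2) / 5

/-- The value of `y (1 - y)²` at `critY`. -/
noncomputable def critZ : ℝ := critY * (1 - critY) ^ 2

theorem lt_critV : 0.31110781746 ≤ critV := exists_critical_root.choose_spec.1

theorem critV_lt : critV ≤ 0.31110781747 := exists_critical_root.choose_spec.2.1

theorem critV_eq : critV ^ 3 - critV ^ 2 - 3 * critV + 1 = 0 :=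
  exists_critical_root.choose_spec.2.2

theorem lt_critV_sq : 0.31110781746 ^ 2 ≤ critV ^ 2 :=
  pow_le_pow_left₀ (by norm_num) lt_critV 2

theorem critV_sq_lt : critV ^ 2 ≤ 0.31110781747 ^ 2 :=
  pow_le_pow_left₀ (by linarith [lt_critV]) critV_lt 2

theorem critY_mul : critY * (1 + critV - critV ^ 2) = critV * (1 - critV) ^ 2 := by
  unfold critY
  linear_combination (-critV / 5 + 3 / 5) * critV_eq

theorem lt_critY : 0.12158510 ≤ critY := by
  unfold critY
  linarith [critV_lt, lt_critV_sq]

theorem critY_lt : critY ≤ 0.12158511 := by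
  unfold critY
  linarith [lt_critV, critV_sq_lt]

/-- The reduction of `critZ` modulo the minimal polynomial of `critV`. -/
theorem critZ_eq : critZ = (407 - 1292 * critV + 69 * critV ^ 2) / 125 := by
  unfold critZ critY
  have h := critV_eq
  have h3 : critV ^ 3 = critV ^ 2 + 3 * critV - 1 := by linarith
  have h4 : critV ^ 4 = 4 * critV ^ 2 + 2 * critV - 1 := by linear_combination (critV + 1) * h
  have h5 : critV ^ 5 = 6 * critV ^ 2 + 11 * critV - 4 := by
    linear_combination (critV ^ 2 + critV + 4) * h
  have h6 : critV ^ 6 = 17 * critV ^ 2 + 14 * critV - 6 := by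
    linear_combination (critV ^ 3 + critV ^ 2 + 4 * critV + 6) * h
  ring_nf
  rw [h3, h4, h5, h6]
  ring

theorem critZ_pos : 0 < critZ := by
  rw [critZ_eq]
  linarith [critV_lt, lt_critV_sq]

theorem critZ_root : 125 * critZ ^ 3 - 412 * critZ ^ 2 - 40936 * critZ + 3844 = 0 := by
  rw [critZ_eq]
  have h := critV_eq
  have h3 : critV ^ 3 = critV ^ 2 + 3 * critV - 1 := by linarith
  have h4 : critV ^ 4 = 4 * critV ^ 2 + 2 * critV - 1 := by linear_combination (critV + 1) * h
  have h5 : critV ^ 5 = 6 * critV ^ 2 + 11 * critV - 4 := by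
    linear_combination (critV ^ 2 + critV + 4) * h
  have h6 : critV ^ 6 = 17 * critV ^ 2 + 14 * critV - 6 := by
    linear_combination (critV ^ 3 + critV ^ 2 + 4 * critV + 6) * h
  ring_nf
  rw [h3, h4, h5, h6]
  ring

theorem abs_critZ_sub : |critZ - 0.0938166| ≤ 0.00000005 := by
  rw [critZ_eq, abs_le]
  constructor <;> linarith [lt_critV, critV_lt, lt_critV_sq, critV_sq_lt]

theorem abs_growth_sub : |1 / (4 * critZ) - 2.66477| ≤ 0.000005 := by
  have h1 : 0.0938166 ≤ critZ ∧ critZ ≤ 0.0938167 := by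
    rw [critZ_eq]
    constructor <;> linarith [lt_critV, critV_lt, lt_critV_sq, critV_sq_lt]
  have h2 : (0 : ℝ) < 4 * critZ := by linarith [critZ_pos]
  rw [abs_le]
  constructor
  · rw [neg_le_sub_iff_le_add, ← sub_le_iff_le_add, le_div_iff₀ h2]
    linarith [h1.1, h1.2]
  · rw [sub_le_iff_le_add, div_le_iff₀ h2]
    linarith [h1.1, h1.2]

namespace OrderedTree

/-! ### Convergence on the closed disc of radius `critZ` -/

/-- A simultaneous bound for the four basic sums, by induction on the number of vertices: the
bounds are chosen to be stable under the recursive description of trees. -/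
theorem truncSum_le {x : ℝ≥0∞} {a₀ a₁ u₀ u₁ : ℝ≥0∞}
    (h1 : x * (1 - (a₀ + a₁))⁻¹ ≤ a₀) (h2 : x * (1 - a₀)⁻¹ ≤ a₁)
    (h3 : x * (1 - (a₀ + a₁ + (u₀ + u₁)))⁻¹ ≤ u₀) (h4 : x * (1 - (a₀ + u₀))⁻¹ ≤ u₁) (h : ℕ) :
    truncSum (fun t => (t.sigmaOut : ℝ≥0∞) * x ^ t.order) h ≤ a₀ ∧
    truncSum (fun t => (t.sigmaIn : ℝ≥0∞) * x ^ t.order) h ≤ a₁ ∧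
    truncSum (fun t => ((t.sigmaOut * t.rootedRho : ℕ) : ℝ≥0∞) * x ^ t.order) h ≤ u₀ ∧
    truncSum (fun t => ((t.sigmaIn * t.rootedRho : ℕ) : ℝ≥0∞) * x ^ t.order) h ≤ u₁ := by
  induction h with
  | zero => simp [truncSum_zero]
  | succ h ih =>
    obtain ⟨i1, i2, i3, i4⟩ := ih
    refine ⟨?_, ?_, ?_, ?_⟩
    · refine le_trans (truncSum_succ_le (fun l => node_term (sigmaOut_node l) x) h) (le_trans ?_ h1)
      have : (fun t : OrderedTree => (t.sigmaIndex : ℝ≥0∞) * x ^ t.order) = fun t =>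
          (t.sigmaOut : ℝ≥0∞) * x ^ t.order + (t.sigmaIn : ℝ≥0∞) * x ^ t.order := by
        funext t
        rw [sigmaIndex_eq_add]
        push_cast
        ring
      rw [this, truncSum_add]
      gcongr
    · refine le_trans (truncSum_succ_le (fun l => node_term (sigmaIn_node l) x) h) (le_trans ?_ h2)
      gcongr
    · refine le_trans (truncSum_succ_le (fun l => node_term (c := fun t => t.sigmaOut * t.rootedRho)
        (sigmaOut_mul_rootedRho_node l) x) h) (le_trans ?_ h3)
      have : (fun t : OrderedTree => ((t.sigmaIndex * (1 + t.rootedRho) : ℕ) : ℝ≥0∞) * x ^ t.order)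
          = fun t => ((t.sigmaOut : ℝ≥0∞) * x ^ t.order + (t.sigmaIn : ℝ≥0∞) * x ^ t.order) +
            (((t.sigmaOut * t.rootedRho : ℕ) : ℝ≥0∞) * x ^ t.order +
              ((t.sigmaIn * t.rootedRho : ℕ) : ℝ≥0∞) * x ^ t.order) := by
        funext t
        rw [sigmaIndex_eq_add]
        push_cast
        ring
      rw [this, truncSum_add, truncSum_add, truncSum_add]
      gcongr
    · refine le_trans (truncSum_succ_le (fun l => node_term (c := fun t => t.sigmaIn * t.rootedRho)
        (sigmaIn_mul_rootedRho_node l) x) h) (le_trans ?_ h4)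
      have : (fun t : OrderedTree => ((t.sigmaOut * (1 + t.rootedRho) : ℕ) : ℝ≥0∞) * x ^ t.order)
          = fun t => (t.sigmaOut : ℝ≥0∞) * x ^ t.order +
            ((t.sigmaOut * t.rootedRho : ℕ) : ℝ≥0∞) * x ^ t.order := by
        funext t
        push_cast
        ring
      rw [this, truncSum_add]
      gcongr

theorem convergesAt_of_tsum_le {c : OrderedTree → ℕ} {x b : ℝ} (hx : 0 ≤ x) (hb : 0 ≤ b)
    (h : ∀ n, truncSum (fun t => (c t : ℝ≥0∞) * ENNReal.ofReal x ^ t.order) n ≤ ENNReal.ofReal b) :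
    ConvergesAt c x ∧ ∑' t, (c t : ℝ) * x ^ t.order ≤ b := by
  have h1 : ∀ t : OrderedTree, (c t : ℝ≥0∞) * ENNReal.ofReal x ^ t.order =
      ENNReal.ofReal ((c t : ℝ) * x ^ t.order) := fun t => by
    rw [ENNReal.ofReal_mul (by positivity), ENNReal.ofReal_pow hx, ENNReal.ofReal_natCast]
  have h2 := tsum_le_of_truncSum_le h
  simp only [h1] at h2
  have hnn : ∀ t : OrderedTree, 0 ≤ (c t : ℝ) * x ^ t.order := fun t => by positivity
  have h3 : ConvergesAt c x :=
    (ENNReal.summable_toReal (h2.trans_lt ENNReal.ofReal_lt_top).ne).congr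
      fun t => ENNReal.toReal_ofReal (hnn t)
  refine ⟨h3, ?_⟩
  rw [← ENNReal.ofReal_tsum_of_nonneg hnn h3] at h2
  exact (ENNReal.ofReal_le_ofReal_iff hb).1 h2

theorem ofReal_mul_inv_one_sub_le {x s b : ℝ} (hs : 0 ≤ s) (hs1 : s < 1)
    (h : x ≤ b * (1 - s)) :
    ENNReal.ofReal x * (1 - ENNReal.ofReal s)⁻¹ ≤ ENNReal.ofReal b := by
  have h1 : 0 < 1 - s := by linarith
  rw [← ENNReal.ofReal_one, ← ENNReal.ofReal_sub 1 hs, ← ENNReal.ofReal_inv_of_pos h1,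
    mul_comm, ← ENNReal.ofReal_mul (by positivity)]
  refine ENNReal.ofReal_le_ofReal ?_
  rwa [mul_comm, ← div_eq_mul_inv, div_le_iff₀ h1]

/-- At `critZ` the bounds are the values at `critV` of the rational functions that parametrize the
four generating functions. -/
theorem convergesAt_critZ :
    (ConvergesAt sigmaOut critZ ∧ ∑' t, (sigmaOut t : ℝ) * critZ ^ t.order ≤ critY) ∧
    (ConvergesAt sigmaIn critZ ∧
      ∑' t, (sigmaIn t : ℝ) * critZ ^ t.order ≤ critY * (1 - critY)) ∧
    (ConvergesAt (fun t => t.sigmaOut * t.rootedRho) critZ ∧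
      ∑' t : OrderedTree, ((t.sigmaOut * t.rootedRho : ℕ) : ℝ) * critZ ^ t.order ≤
        (1 - critY) * critV) ∧
    (ConvergesAt (fun t => t.sigmaIn * t.rootedRho) critZ ∧
      ∑' t : OrderedTree, ((t.sigmaIn * t.rootedRho : ℕ) : ℝ) * critZ ^ t.order ≤
        critY * (1 - critY) / (1 - critV)) := by
  have hv1 := lt_critV
  have hv2 := critV_lt
  have hy1 := lt_critY
  have hy2 := critY_lt
  have hv : 0 < critV := by linarith
  have hv' : 0 < 1 - critV := by linarith
  have hy : 0 < critY := by linarith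
  have hy' : 0 < 1 - critY := by linarith
  have hz := critZ_pos
  have p0 : 0 ≤ critY := hy.le
  have p1 : 0 ≤ critY * (1 - critY) := by positivity
  have p2 : 0 ≤ (1 - critY) * critV := by positivity
  have p3 : 0 ≤ critY * (1 - critY) / (1 - critV) := by positivity
  have e : 1 - (critY + critY * (1 - critY) +
      ((1 - critY) * critV + critY * (1 - critY) / (1 - critV))) =
        critY * (1 - critY) / critV := by
    field_simp
    linear_combination (critY - 1) * critY_mul
  have key := truncSum_le (x := ENNReal.ofReal critZ) (a₀ := ENNReal.ofReal critY)
    (a₁ := ENNReal.ofReal (critY * (1 - critY))) (u₀ := ENNReal.ofReal ((1 - critY) * critV))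
    (u₁ := ENNReal.ofReal (critY * (1 - critY) / (1 - critV)))
    (by
      rw [← ENNReal.ofReal_add p0 p1]
      refine ofReal_mul_inv_one_sub_le (by positivity) (by nlinarith) (le_of_eq ?_)
      unfold critZ; ring)
    (by
      refine ofReal_mul_inv_one_sub_le (by positivity) (by linarith) (le_of_eq ?_)
      unfold critZ; ring)
    (by
      rw [← ENNReal.ofReal_add p0 p1, ← ENNReal.ofReal_add p2 p3,
        ← ENNReal.ofReal_add (by positivity) (by positivity)]
      refine ofReal_mul_inv_one_sub_le (by positivity) ?_ (le_of_eq ?_)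
      · have : 0 < critY * (1 - critY) / critV := by positivity
        linarith
      · rw [e]; unfold critZ; field_simp)
    (by
      rw [← ENNReal.ofReal_add p0 p2]
      refine ofReal_mul_inv_one_sub_le (by positivity) (by nlinarith) (le_of_eq ?_)
      unfold critZ; field_simp; ring)
  exact ⟨convergesAt_of_tsum_le hz.le p0 fun n => (key n).1,
    convergesAt_of_tsum_le hz.le p1 fun n => (key n).2.1,
    convergesAt_of_tsum_le hz.le p2 fun n => (key n).2.2.1,
    convergesAt_of_tsum_le hz.le p3 fun n => (key n).2.2.2⟩

end OrderedTree

/-! ### The rational parametrization -/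

/-- The generating function of `sigmaOut` in terms of the uniformizing parameter. -/
noncomputable def paramY (v : ℂ) : ℂ := v * (1 - v) ^ 2 / (1 + v - v ^ 2)

/-- The variable `z` in terms of the uniformizing parameter. -/
noncomputable def paramZ (v : ℂ) : ℂ := paramY v * (1 - paramY v) ^ 2

/-- The generating function `SR` in terms of the uniformizing parameter. -/
noncomputable def paramSR (v : ℂ) : ℂ :=
  (1 - paramY v) ^ 3 * ((1 + paramY v) * v + paramY v / (1 - v)) / (1 - 3 * paramY v)

theorem ne_zero_of_norm_sub_one_lt {w : ℂ} (h : ‖w - 1‖ < 1) : w ≠ 0 := by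
  rintro rfl
  simp at h

theorem denom_ne_zero {v : ℂ} (hv : ‖v‖ ≤ critV) : 1 + v - v ^ 2 ≠ 0 := by
  refine ne_zero_of_norm_sub_one_lt ?_
  have h1 : 1 + v - v ^ 2 - 1 = v - v ^ 2 := by ring
  have h2 : ‖v ^ 2‖ ≤ critV ^ 2 := by rw [norm_pow]; gcongr
  rw [h1]
  have := norm_sub_le v (v ^ 2)
  linarith [critV_sq_lt, critV_lt]

theorem one_sub_ne_zero {v : ℂ} (hv : ‖v‖ ≤ critV) : 1 - v ≠ 0 := by
  refine ne_zero_of_norm_sub_one_lt ?_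
  have h1 : 1 - v - 1 = -v := by ring
  rw [h1, norm_neg]
  linarith [critV_lt]

theorem one_sub_ne_zero_of_le_critY {y : ℂ} (hy : ‖y‖ ≤ critY) : 1 - y ≠ 0 :=
  one_sub_ne_zero (hy.trans (by linarith [critY_lt, lt_critV]))

theorem one_sub_three_mul_ne_zero {y : ℂ} (hy : ‖y‖ ≤ critY) : 1 - 3 * y ≠ 0 := by
  refine ne_zero_of_norm_sub_one_lt ?_
  have h1 : 1 - 3 * y - 1 = -(3 * y) := by ring
  rw [h1, norm_neg, norm_mul, Complex.norm_ofNat]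
  linarith [critY_lt]

/-- The third zero of `v (1 - v)² - critY (1 + v - v²)`, besides the double zero at `critV`. -/
noncomputable def critC : ℝ := (7 - 2 * critV - critV ^ 2) / 5

/-- The quotient of `critZ - y (1 - y)²` by `critY - y`. -/
noncomputable def cofactorY (y : ℂ) : ℂ :=
  1 - 2 * (y + critY) + y ^ 2 + y * critY + critY ^ 2

theorem cofactorY_ne_zero {y : ℂ} (hy : ‖y‖ ≤ critY) : cofactorY y ≠ 0 := by
  refine ne_zero_of_norm_sub_one_lt ?_
  have h1 : cofactorY y - 1 = -(2 * (y + critY)) + (y ^ 2 + y * critY + critY ^ 2) := by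
    unfold cofactorY; ring
  have hc : ‖(critY : ℂ)‖ = critY := by
    rw [Complex.norm_real, Real.norm_of_nonneg (by linarith [lt_critY])]
  have h0 : 0 ≤ critY := by linarith [lt_critY]
  have h2 : ‖-(2 * (y + critY))‖ ≤ 4 * critY := by
    rw [norm_neg, norm_mul, Complex.norm_ofNat]
    have := norm_add_le y (critY : ℂ)
    linarith
  have h3 : ‖y ^ 2 + y * critY + critY ^ 2‖ ≤ 3 * critY ^ 2 := by
    refine (norm_add₃_le).trans ?_
    rw [norm_pow, norm_mul, norm_pow, hc]
    nlinarith [norm_nonneg y, pow_le_pow_left₀ (norm_nonneg y) hy 2]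
  rw [h1]
  refine (norm_add_le _ _).trans_lt ?_
  nlinarith [critY_lt]

theorem critZ_sub (y : ℂ) : (critZ : ℂ) - y * (1 - y) ^ 2 = (critY - y) * cofactorY y := by
  unfold critZ cofactorY
  push_cast
  ring

theorem critV_eq_complex : (critV : ℂ) ^ 3 - critV ^ 2 - 3 * critV + 1 = 0 := by
  exact_mod_cast critV_eq

theorem critY_sub_paramY {v : ℂ} (hv : 1 + v - v ^ 2 ≠ 0) :
    (critY : ℂ) - paramY v = (critV - v) ^ 2 * ((critC - v) / (1 + v - v ^ 2)) := by
  unfold paramY critY critC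
  push_cast
  field_simp
  linear_combination (3 + critV - 2 * v : ℂ) * critV_eq_complex

/-- The analytic factor `k` in `1 - paramZ v / critZ = (critV - v)² k(v)`. -/
noncomputable def cofactorV (v : ℂ) : ℂ :=
  (critC - v) / (1 + v - v ^ 2) * cofactorY (paramY v) / critZ

theorem critZ_ne_zero : (critZ : ℂ) ≠ 0 := by exact_mod_cast critZ_pos.ne'

theorem one_sub_paramZ_div {v : ℂ} (hv : 1 + v - v ^ 2 ≠ 0) :
    1 - paramZ v / critZ = (critV - v) ^ 2 * cofactorV v := by
  have h1 := critZ_sub (paramY v)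
  rw [critY_sub_paramY hv] at h1
  have h2 : 1 - paramZ v / critZ = (critZ - paramZ v) / critZ := by
    rw [sub_div, div_self critZ_ne_zero]
  rw [h2, paramZ, h1, cofactorV]
  ring

theorem critC_sub_ne_zero {v : ℂ} (hv : ‖v‖ ≤ critV) : (critC : ℂ) - v ≠ 0 := by
  intro h
  have h1 : v = critC := (sub_eq_zero.1 h).symm
  have h2 : (0 : ℝ) < critC := by unfold critC; linarith [critV_lt, critV_sq_lt]
  rw [h1, Complex.norm_real, Real.norm_of_nonneg h2.le] at hv
  unfold critC at hv
  linarith [critV_lt, critV_sq_lt]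

theorem eq_critV_of_paramZ_eq {v : ℂ} (hv : ‖v‖ ≤ critV) (hy : ‖paramY v‖ ≤ critY)
    (h : paramZ v = critZ) : v = critV := by
  have h1 := one_sub_paramZ_div (denom_ne_zero hv)
  rw [h, div_self critZ_ne_zero, sub_self] at h1
  have h2 : cofactorV v ≠ 0 := by
    unfold cofactorV
    exact div_ne_zero (mul_ne_zero (div_ne_zero (critC_sub_ne_zero hv) (denom_ne_zero hv))
      (cofactorY_ne_zero hy)) critZ_ne_zero
  have h3 := (mul_eq_zero.1 h1.symm).resolve_right h2
  exact (sub_eq_zero.1 (pow_eq_zero_iff (two_ne_zero) |>.1 h3)).symm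

theorem paramY_critV : paramY critV = critY := by
  have h : (1 + critV - critV ^ 2 : ℂ) ≠ 0 := denom_ne_zero (by
    rw [Complex.norm_real, Real.norm_of_nonneg (by linarith [lt_critV])])
  rw [paramY, div_eq_iff h]
  exact_mod_cast critY_mul.symm

theorem paramZ_critV : paramZ critV = critZ := by
  rw [paramZ, paramY_critV, critZ]
  push_cast
  ring

/-- The derivative of `paramY` vanishes only at the zeros of `(1 - v) (v³ - v² - 3 v + 1)`. -/
theorem hasDerivAt_paramY {v : ℂ} (hv : 1 + v - v ^ 2 ≠ 0) :
    HasDerivAt paramY ((1 - v) * (v ^ 3 - v ^ 2 - 3 * v + 1) / (1 + v - v ^ 2) ^ 2) v := by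
  have h1 : HasDerivAt (fun v : ℂ => v * (1 - v) ^ 2)
      (1 * (1 - v) ^ 2 + v * (2 * (1 - v) ^ 1 * (-1))) v :=
    (hasDerivAt_id' v).mul (((hasDerivAt_id' v).const_sub 1).pow 2)
  have h2 : HasDerivAt (fun v : ℂ => 1 + v - v ^ 2) (1 - 2 * v ^ 1 * 1) v :=
    ((hasDerivAt_id' v).const_add 1).sub ((hasDerivAt_id' v).pow 2)
  refine (h1.div h2 hv).congr_deriv ?_
  congr 1
  ring

theorem hasDerivAt_paramZ {v : ℂ} (hv : 1 + v - v ^ 2 ≠ 0) :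
    HasDerivAt paramZ ((1 - paramY v) * (1 - 3 * paramY v) *
      ((1 - v) * (v ^ 3 - v ^ 2 - 3 * v + 1) / (1 + v - v ^ 2) ^ 2)) v := by
  have h := hasDerivAt_paramY hv
  have h2 : HasDerivAt (fun v : ℂ => (1 - paramY v) ^ 2) (2 * (1 - paramY v) ^ 1 *
      (-((1 - v) * (v ^ 3 - v ^ 2 - 3 * v + 1) / (1 + v - v ^ 2) ^ 2))) v :=
    (h.const_sub 1).pow 2
  refine (h.mul h2).congr_deriv ?_
  ring

/-- In the closed disc of radius `critV`, the cubic has no zero besides `critV`. -/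
theorem cubic_ne_zero {v : ℂ} (hv : ‖v‖ ≤ critV) (hne : v ≠ critV) :
    v ^ 3 - v ^ 2 - 3 * v + 1 ≠ 0 := by
  have h1 : v ^ 3 - v ^ 2 - 3 * v + 1 =
      (v - critV) * (v ^ 2 + (critV - 1) * v + (critV ^ 2 - critV - 3)) := by
    linear_combination critV_eq_complex
  rw [h1]
  refine mul_ne_zero (sub_ne_zero.2 hne) fun h => ?_
  have hc : ‖(critV : ℂ)‖ = critV := by
    rw [Complex.norm_real, Real.norm_of_nonneg (by linarith [lt_critV])]
  have h2 : (3 : ℂ) = v ^ 2 + (critV - 1) * v + (critV ^ 2 - critV) := by linear_combination -h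
  have h3 : ‖v ^ 2‖ ≤ critV ^ 2 := by rw [norm_pow]; gcongr
  have h4 : ‖((critV : ℂ) - 1) * v‖ ≤ critV + 1 := by
    rw [norm_mul]
    have := norm_sub_le (critV : ℂ) 1
    rw [hc, norm_one] at this
    nlinarith [norm_nonneg v, critV_lt, lt_critV, norm_nonneg ((critV : ℂ) - 1)]
  have h5 : ‖(critV : ℂ) ^ 2 - critV‖ ≤ critV ^ 2 + critV := by
    refine (norm_sub_le _ _).trans ?_
    rw [norm_pow, hc]
  have h6 := congrArg norm h2
  rw [Complex.norm_ofNat] at h6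
  have h7 := norm_add₃_le (a := v ^ 2) (b := ((critV : ℂ) - 1) * v) (c := (critV : ℂ) ^ 2 - critV)
  linarith [critV_lt, critV_sq_lt]

theorem deriv_paramZ_ne_zero {v : ℂ} (hv : ‖v‖ ≤ critV) (hy : ‖paramY v‖ ≤ critY)
    (hne : v ≠ critV) : deriv paramZ v ≠ 0 := by
  rw [(hasDerivAt_paramZ (denom_ne_zero hv)).deriv]
  exact mul_ne_zero (mul_ne_zero (one_sub_ne_zero_of_le_critY hy) (one_sub_three_mul_ne_zero hy))
    (div_ne_zero (mul_ne_zero (one_sub_ne_zero hv) (cubic_ne_zero hv hne))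
      (pow_ne_zero 2 (denom_ne_zero hv)))

theorem analyticAt_paramY {v : ℂ} (hv : ‖v‖ ≤ critV) : AnalyticAt ℂ paramY v := by
  unfold paramY
  exact AnalyticAt.div (by fun_prop) (by fun_prop) (denom_ne_zero hv)

theorem analyticAt_paramZ {v : ℂ} (hv : ‖v‖ ≤ critV) : AnalyticAt ℂ paramZ v :=
  (analyticAt_paramY hv).mul ((analyticAt_const.sub (analyticAt_paramY hv)).pow 2)

theorem analyticAt_paramSR {v : ℂ} (hv : ‖v‖ ≤ critV) (hy : ‖paramY v‖ ≤ critY) :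
    AnalyticAt ℂ paramSR v := by
  have h := analyticAt_paramY hv
  have h1 : AnalyticAt ℂ (fun v : ℂ => 1 - v) v := by fun_prop
  exact (((analyticAt_const.sub h).pow 3).mul (((analyticAt_const.add h).mul analyticAt_id).add
    (h.div h1 (one_sub_ne_zero hv)))).div (analyticAt_const.sub (analyticAt_const.mul h))
      (one_sub_three_mul_ne_zero hy)

namespace OrderedTree

/-! ### The uniformizing parameter as a function on the disc -/

/-- The uniformizing parameter in terms of the tree generating functions. -/
noncomputable def treeV (z : ℂ) : ℂ :=
  genFun (fun t => t.sigmaOut * t.rootedRho) z / (1 - genFun sigmaOut z)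

section ClosedDisc

variable {z : ℂ}

theorem norm_genFun_sigmaOut_le (hz : ‖z‖ ≤ critZ) : ‖genFun sigmaOut z‖ ≤ critY :=
  (convergesAt_critZ.1.1.norm_genFun_le critZ_pos.le hz).trans convergesAt_critZ.1.2

theorem norm_treeV_le (hz : ‖z‖ ≤ critZ) : ‖treeV z‖ ≤ critV := by
  have h1 := norm_genFun_sigmaOut_le hz
  have h2 : ‖genFun (fun t => t.sigmaOut * t.rootedRho) z‖ ≤ (1 - critY) * critV :=
    (convergesAt_critZ.2.2.1.1.norm_genFun_le critZ_pos.le hz).trans convergesAt_critZ.2.2.1.2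
  have h3 : 1 - critY ≤ ‖1 - genFun sigmaOut z‖ := by
    have := norm_sub_norm_le (1 : ℂ) (genFun sigmaOut z)
    rw [norm_one] at this
    linarith
  have h4 : 0 < 1 - critY := by linarith [critY_lt]
  rw [treeV, norm_div, div_le_iff₀ (by linarith)]
  nlinarith [lt_critV]

theorem continuousOn_treeV : ContinuousOn treeV (Metric.closedBall 0 critZ) := by
  refine (convergesAt_critZ.2.2.1.1.continuousOn critZ_pos.le).div
    (continuousOn_const.sub (convergesAt_critZ.1.1.continuousOn critZ_pos.le)) fun z hz => ?_
  exact one_sub_ne_zero_of_le_critY (norm_genFun_sigmaOut_le (by simpa using hz))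

theorem sigmaIndex_eq : sigmaIndex = fun t => t.sigmaOut + t.sigmaIn := by
  funext t
  exact sigmaIndex_eq_add t

theorem convergesAt_sigmaIndex : ConvergesAt sigmaIndex critZ ∧
    ∑' t : OrderedTree, (t.sigmaIndex : ℝ) * critZ ^ t.order < 1 := by
  obtain ⟨⟨h1, h1'⟩, ⟨h2, h2'⟩, -, -⟩ := convergesAt_critZ
  rw [sigmaIndex_eq]
  refine ⟨h1.add h2, ?_⟩
  have : ∑' t : OrderedTree, ((t.sigmaOut + t.sigmaIn : ℕ) : ℝ) * critZ ^ t.order =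
      ∑' t, (sigmaOut t : ℝ) * critZ ^ t.order + ∑' t, (sigmaIn t : ℝ) * critZ ^ t.order := by
    rw [← Summable.tsum_add h1 h2]
    exact tsum_congr fun t => by push_cast; ring
  rw [this]
  nlinarith [critY_lt, lt_critY]

theorem convergesAt_sigmaOut_mul : ConvergesAt (fun t => t.sigmaOut * (1 + t.rootedRho)) critZ ∧
    ∑' t : OrderedTree, ((t.sigmaOut * (1 + t.rootedRho) : ℕ) : ℝ) * critZ ^ t.order < 1 := by
  obtain ⟨⟨h1, h1'⟩, -, ⟨h2, h2'⟩, -⟩ := convergesAt_critZ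
  have e : (fun t : OrderedTree => t.sigmaOut * (1 + t.rootedRho)) =
      fun t => t.sigmaOut + t.sigmaOut * t.rootedRho := by funext t; ring
  refine ⟨e ▸ h1.add h2, ?_⟩
  have : ∑' t : OrderedTree, ((t.sigmaOut * (1 + t.rootedRho) : ℕ) : ℝ) * critZ ^ t.order =
      ∑' t, (sigmaOut t : ℝ) * critZ ^ t.order +
        ∑' t : OrderedTree, ((t.sigmaOut * t.rootedRho : ℕ) : ℝ) * critZ ^ t.order := by
    rw [← Summable.tsum_add h1 h2]
    exact tsum_congr fun t => by push_cast; ring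
  rw [this]
  nlinarith [critY_lt, lt_critY, critV_lt, lt_critV]

theorem convergesAt_sigmaIndex_mul :
    ConvergesAt (fun t => t.sigmaIndex * (1 + t.rootedRho)) critZ ∧
    ∑' t : OrderedTree, ((t.sigmaIndex * (1 + t.rootedRho) : ℕ) : ℝ) * critZ ^ t.order < 1 := by
  obtain ⟨⟨h1, h1'⟩, ⟨h2, h2'⟩, ⟨h3, h3'⟩, ⟨h4, h4'⟩⟩ := convergesAt_critZ
  have e : (fun t : OrderedTree => t.sigmaIndex * (1 + t.rootedRho)) =
      fun t => (t.sigmaOut + t.sigmaIn) +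
        (t.sigmaOut * t.rootedRho + t.sigmaIn * t.rootedRho) := by
    funext t; rw [sigmaIndex_eq]; ring
  refine ⟨e ▸ (h1.add h2).add (h3.add h4), ?_⟩
  have : ∑' t : OrderedTree, ((t.sigmaIndex * (1 + t.rootedRho) : ℕ) : ℝ) * critZ ^ t.order =
      (∑' t, (sigmaOut t : ℝ) * critZ ^ t.order + ∑' t, (sigmaIn t : ℝ) * critZ ^ t.order) +
        (∑' t : OrderedTree, ((t.sigmaOut * t.rootedRho : ℕ) : ℝ) * critZ ^ t.order +
        ∑' t : OrderedTree, ((t.sigmaIn * t.rootedRho : ℕ) : ℝ) * critZ ^ t.order) := by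
    rw [← Summable.tsum_add h1 h2, ← Summable.tsum_add h3 h4,
      ← Summable.tsum_add (Summable.add h1 h2) (Summable.add h3 h4)]
    exact tsum_congr fun t => by rw [sigmaIndex_eq]; push_cast; ring
  rw [this]
  have h5 : critY * (1 - critY) / (1 - critV) ≤ 0.2 := by
    rw [div_le_iff₀ (by linarith [critV_lt])]
    nlinarith [critY_lt, lt_critY, critV_lt, lt_critV]
  nlinarith [critY_lt, lt_critY, critV_lt, lt_critV]

/-- The functional equations of the four basic generating functions, solved in terms of `treeV`. -/
theorem genFun_system (hz : ‖z‖ ≤ critZ) :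
    z = genFun sigmaOut z * (1 - genFun sigmaOut z) ^ 2 ∧
    genFun sigmaIndex z = 2 * genFun sigmaOut z - genFun sigmaOut z ^ 2 ∧
    genFun sigmaOut z = paramY (treeV z) ∧
    genFun (fun t => t.sigmaIn * t.rootedRho) z * (1 - treeV z) =
      genFun sigmaOut z * (1 - genFun sigmaOut z) := by
  have hx := critZ_pos.le
  obtain ⟨⟨h1, h1'⟩, ⟨h2, h2'⟩, ⟨h3, h3'⟩, ⟨h4, h4'⟩⟩ := convergesAt_critZ
  have s1 := h1.summable_norm hx hz
  have s2 := h2.summable_norm hx hz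
  have s3 := h3.summable_norm hx hz
  have s4 := h4.summable_norm hx hz
  have e1 := genFun_mul_one_sub sigmaOut_node hx convergesAt_sigmaIndex.1
    convergesAt_sigmaIndex.2 hz
  have e2 := genFun_mul_one_sub sigmaIn_node hx h1
    (h1'.trans_lt (by linarith [critY_lt])) hz
  have e3 := genFun_mul_one_sub (c := fun t => t.sigmaOut * t.rootedRho)
    sigmaOut_mul_rootedRho_node hx convergesAt_sigmaIndex_mul.1
    convergesAt_sigmaIndex_mul.2 hz
  have e4 := genFun_mul_one_sub (c := fun t => t.sigmaIn * t.rootedRho)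
    sigmaIn_mul_rootedRho_node hx convergesAt_sigmaOut_mul.1 convergesAt_sigmaOut_mul.2 hz
  have a1 : genFun sigmaIndex z = genFun sigmaOut z + genFun sigmaIn z := by
    rw [sigmaIndex_eq]; exact genFun_add s1 s2
  have a2 : genFun (fun t => t.sigmaOut * (1 + t.rootedRho)) z =
      genFun sigmaOut z + genFun (fun t => t.sigmaOut * t.rootedRho) z := by
    rw [← genFun_add s1 s3]
    congr 1; funext t; ring
  have a3 : genFun (fun t => t.sigmaIndex * (1 + t.rootedRho)) z =
      (genFun sigmaOut z + genFun sigmaIn z) + (genFun (fun t => t.sigmaOut * t.rootedRho) z +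
        genFun (fun t => t.sigmaIn * t.rootedRho) z) := by
    rw [← genFun_add s1 s2, ← genFun_add s3 s4,
      ← genFun_add ((h1.add h2).summable_norm hx hz) ((h3.add h4).summable_norm hx hz)]
    congr 1; funext t; rw [sigmaIndex_eq]; ring
  have hy := norm_genFun_sigmaOut_le hz
  have hq := one_sub_ne_zero_of_le_critY hy
  have hv := norm_treeV_le hz
  have hU : genFun (fun t => t.sigmaOut * t.rootedRho) z =
      (1 - genFun sigmaOut z) * treeV z := by
    unfold treeV; field_simp
  rw [a3, hU] at e3
  rw [a2, hU] at e4
  rw [a1] at e1 ⊢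
  generalize genFun sigmaOut z = y at *
  generalize treeV z = v at *
  generalize genFun sigmaIn z = s at *
  generalize genFun (fun t => t.sigmaIn * t.rootedRho) z = u at *
  -- elimination from `y (1 - y - s) = z`, `s (1 - y) = z` and the two equations for `v` and `u`
  have r1 : s = y - y ^ 2 := by linear_combination e2 - e1
  subst r1
  have r2 : z = y * (1 - y) ^ 2 := by rw [← e1]; ring
  have r3 : u * (1 - v) = y * (1 - y) := by
    apply mul_left_cancel₀ hq
    linear_combination e4 + r2
  refine ⟨r2, by ring, ?_, r3⟩
  rw [paramY, eq_div_iff (denom_ne_zero hv)]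
  apply mul_left_cancel₀ (pow_ne_zero 2 hq)
  linear_combination (1 - v) * (-r2 - e3) - (1 - y) * v * r3

theorem norm_paramY_treeV_le (hz : ‖z‖ ≤ critZ) : ‖paramY (treeV z)‖ ≤ critY := by
  rw [← (genFun_system hz).2.2.1]
  exact norm_genFun_sigmaOut_le hz

theorem paramZ_treeV (hz : ‖z‖ ≤ critZ) : paramZ (treeV z) = z := by
  rw [paramZ, ← (genFun_system hz).2.2.1]
  exact (genFun_system hz).1.symm

theorem treeV_critZ : treeV critZ = critV := by
  have hz : ‖(critZ : ℂ)‖ ≤ critZ := by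
    rw [Complex.norm_real, Real.norm_of_nonneg critZ_pos.le]
  exact eq_critV_of_paramZ_eq (norm_treeV_le hz) (norm_paramY_treeV_le hz) (paramZ_treeV hz)

end ClosedDisc

end OrderedTree

/-! ### The local expansion at the critical point -/

theorem exists_analytic_localInverse {f : ℂ → ℂ} {x : ℂ} (hf : AnalyticAt ℂ f x)
    (hf' : deriv f x ≠ 0) :
    ∃ g : ℂ → ℂ, AnalyticAt ℂ g (f x) ∧ g (f x) = x ∧ deriv g (f x) = (deriv f x)⁻¹ ∧
      ∀ᶠ v in 𝓝 x, g (f v) = v :=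
  have h := hf.hasStrictDerivAt
  ⟨h.localInverse _ _ _ hf', hf.analyticAt_localInverse hf',
    (h.eventually_left_inverse hf').self_of_nhds, (h.to_localInverse hf').hasDerivAt.deriv,
    h.eventually_left_inverse hf'⟩

theorem cpow_half_sq (x : ℂ) : (x ^ (1 / 2 : ℂ)) ^ 2 = x := by
  rw [one_div]
  exact Complex.cpow_ofNat_inv_pow x 2

theorem cpow_half_re_nonneg (x : ℂ) : 0 ≤ (x ^ (1 / 2 : ℂ)).re := by
  rcases eq_or_ne x 0 with rfl | hx
  · simp
  · rw [Complex.cpow_def_of_ne_zero hx, Complex.exp_re]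
    refine mul_nonneg (Real.exp_pos _).le (Real.cos_nonneg_of_mem_Icc ?_)
    have h : (Complex.log x * (1 / 2)).im = x.arg / 2 := by
      rw [show Complex.log x * (1 / 2) = Complex.log x * ((1 / 2 : ℝ) : ℂ) by push_cast; rfl,
        Complex.im_mul_ofReal, Complex.log_im]
      ring
    rw [h]
    exact ⟨by linarith [Complex.neg_pi_lt_arg x], by linarith [Complex.arg_le_pi x]⟩

theorem abs_im_lt_re_of_sq {s : ℂ} (h0 : 0 ≤ s.re) (h : 0 < (s ^ 2).re) : |s.im| < s.re := by
  rw [sq, Complex.mul_re] at h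
  exact abs_lt_of_sq_lt_sq (by nlinarith) h0

/-- The product of two numbers in the sector `|arg| < π / 4` has positive real part. -/
theorem re_mul_pos_of_abs_im_lt_re {s w : ℂ} (hs : |s.im| < s.re) (hw : |w.im| < w.re) :
    0 < (s * w).re := by
  rw [Complex.mul_re]
  have h1 := abs_mul s.im w.im
  have h2 := le_abs_self (s.im * w.im)
  nlinarith [abs_nonneg s.im, abs_nonneg w.im]

theorem re_lt_of_norm_le {v : ℂ} {r : ℝ} (hv : ‖v‖ ≤ r) (hne : v ≠ r) : v.re < r := by
  have h1 := Complex.re_le_norm v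
  refine lt_of_le_of_ne (h1.trans hv) fun h => hne ?_
  have h2 : ‖v‖ = v.re := le_antisymm (by linarith) h1
  have h3 : v.im = 0 := by
    have := Complex.sq_norm v
    rw [Complex.normSq_apply, h2] at this
    nlinarith
  exact Complex.ext (by simpa using h) (by simpa using h3)

/-- The value at `critV` of the factor `k` in `1 - paramZ v / critZ = (critV - v)² k(v)`. -/
noncomputable def critK : ℝ := (1386 + 339 * critV - 583 * critV ^ 2) / 310

/-- The derivative of `paramSR` at `critV`. -/
noncomputable def critQ : ℝ := (13842 - 20102 * critV - 2836 * critV ^ 2) / 4975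

/-- The constant term of the expansion of `SR` at its dominant singularity. -/
noncomputable def critA : ℝ := (-856 + 14136 * critV - 7777 * critV ^ 2) / 4975

/-- The coefficient of the square root in the expansion of `SR` at its dominant singularity. -/
noncomputable def critB : ℝ := critQ / √critK

theorem critK_bounds : 4.6291551 ≤ critK ∧ critK ≤ 4.6291552 := by
  unfold critK
  constructor <;> linarith [lt_critV, critV_lt, lt_critV_sq, critV_sq_lt]

theorem critQ_bounds : 1.4700743 ≤ critQ ∧ critQ ≤ 1.4700744 := by
  unfold critQ
  constructor <;> linarith [lt_critV, critV_lt, lt_critV_sq, critV_sq_lt]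

theorem abs_critA_sub : |critA - 0.560623| ≤ 0.0000005 := by
  unfold critA
  rw [abs_le]
  constructor <;> linarith [lt_critV, critV_lt, lt_critV_sq, critV_sq_lt]

theorem critB_bounds : 0.6832637 ≤ critB ∧ critB ≤ 0.6832639 := by
  have hK := critK_bounds
  have hQ := critQ_bounds
  have h1 : 2.1515471 ≤ √critK := Real.le_sqrt_of_sq_le (by norm_num; linarith [hK.1])
  have h2 : √critK ≤ 2.1515473 := by
    refine Real.sqrt_le_iff.2 ⟨by norm_num, ?_⟩
    norm_num
    linarith [hK.2]
  have h3 : 0 < √critK := by linarith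
  unfold critB
  rw [le_div_iff₀ h3, div_le_iff₀ h3]
  constructor <;> linarith [hQ.1, hQ.2]

section CriticalValues

theorem norm_critV : ‖(critV : ℂ)‖ = critV := by
  rw [Complex.norm_real, Real.norm_of_nonneg (by linarith [lt_critV])]

theorem norm_paramY_critV : ‖paramY critV‖ ≤ critY := by
  rw [paramY_critV, Complex.norm_real, Real.norm_of_nonneg (by linarith [lt_critY])]

theorem one_sub_critV_ne_zero : (1 - critV : ℂ) ≠ 0 := one_sub_ne_zero norm_critV.le

theorem one_sub_three_critY_ne_zero : (1 - 3 * critY : ℂ) ≠ 0 :=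
  paramY_critV ▸ one_sub_three_mul_ne_zero norm_paramY_critV

theorem paramSR_critV : paramSR critV = critA := by
  have h := critV_eq_complex
  have e : (critY : ℂ) / (1 - critV) = (1 - critV + 2 * critV ^ 2) / 5 := by
    rw [div_eq_iff one_sub_critV_ne_zero]
    unfold critY
    push_cast
    linear_combination (2 / 5 : ℂ) * h
  rw [paramSR, paramY_critV, e, div_eq_iff one_sub_three_critY_ne_zero]
  unfold critY critA
  push_cast
  linear_combination (-15528 / 124375 + 369104 / 124375 * critV - 2888 / 625 * critV ^ 2 +
    1476 / 625 * critV ^ 3 - 311 / 625 * critV ^ 4 + 29 / 625 * critV ^ 5 -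
    1 / 625 * critV ^ 6 : ℂ) * h

/-- Since `paramY` is stationary at `critV`, only the explicit dependence of `paramSR` on `v`
contributes to its derivative. -/
theorem deriv_paramSR_critV : deriv paramSR critV = critQ := by
  have h := critV_eq_complex
  have hY : HasDerivAt paramY 0 critV := by
    have := hasDerivAt_paramY (denom_ne_zero norm_critV.le)
    rwa [h, mul_zero, zero_div] at this
  have h1 : HasDerivAt (fun v : ℂ => 1 - v) (-1) critV := (hasDerivAt_id' _).const_sub 1
  have hnum : HasDerivAt (fun v => (1 + paramY v) * v + paramY v / (1 - v))
      ((0 * critV + (1 + paramY critV) * 1) +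
        (0 * (1 - critV) - paramY critV * (-1)) / (1 - critV) ^ 2) critV :=
    ((hY.const_add 1).mul (hasDerivAt_id' _)).add (hY.div h1 one_sub_critV_ne_zero)
  have h3 : HasDerivAt (fun v => (1 - paramY v) ^ 3) ((3 : ℕ) * (1 - paramY critV) ^ 2 * (-0))
      critV := (hY.const_sub 1).pow 3
  have hden : HasDerivAt (fun v => 1 - 3 * paramY v) (-(3 * 0)) critV :=
    (hY.const_mul 3).const_sub 1
  have hall := (h3.mul hnum).div hden (one_sub_three_mul_ne_zero norm_paramY_critV)
  refine Eq.trans (HasDerivAt.deriv (f := paramSR) hall) ?_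
  simp only [paramY_critV]
  have hD := one_sub_three_critY_ne_zero
  have e : (critY : ℂ) / (1 - critV) ^ 2 = (2 - 2 * critV - critV ^ 2) / 5 := by
    rw [div_eq_iff (pow_ne_zero 2 one_sub_critV_ne_zero)]
    unfold critY
    push_cast
    linear_combination (1 / 5 + 1 / 5 * critV : ℂ) * h
  have e2 : (1 - critY : ℂ) ^ 3 * ((1 + critY) + critY / (1 - critV) ^ 2) =
      critQ * (1 - 3 * critY) := by
    rw [e]
    unfold critY critQ
    push_cast
    linear_combination (58552 / 24875 - 201936 / 24875 * critV + 378 / 125 * critV ^ 2 -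
      48 / 125 * critV ^ 3 + 2 / 125 * critV ^ 4 : ℂ) * h
  rw [div_eq_iff (pow_ne_zero 2 hD)]
  have e3 : (0 * (1 - critV) - critY * (-1) : ℂ) / (1 - critV) ^ 2 = critY / (1 - critV) ^ 2 := by
    ring
  rw [e3]
  linear_combination (1 - 3 * critY : ℂ) * e2

theorem cofactorV_critV : cofactorV critV = critK := by
  have h := critV_eq_complex
  have e : (critC - critV : ℂ) / (1 + critV - critV ^ 2) =
      (13 + 22 * critV - 4 * critV ^ 2) / 25 := by
    rw [div_eq_iff (denom_ne_zero norm_critV.le)]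
    unfold critC
    push_cast
    linear_combination (22 / 25 - 4 / 25 * critV : ℂ) * h
  rw [cofactorV, paramY_critV, e, div_eq_iff critZ_ne_zero, critZ_eq]
  unfold cofactorY critY critK
  push_cast
  linear_combination (-11411 / 775 - 56927 / 38750 * critV + 246 / 625 * critV ^ 2 -
    12 / 625 * critV ^ 3 : ℂ) * h

theorem analyticAt_cofactorV {v : ℂ} (hv : ‖v‖ ≤ critV) : AnalyticAt ℂ cofactorV v := by
  have hY := analyticAt_paramY hv
  have h1 : AnalyticAt ℂ (fun v : ℂ => ((critC : ℂ) - v) / (1 + v - v ^ 2)) v :=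
    AnalyticAt.div (by fun_prop) (by fun_prop) (denom_ne_zero hv)
  have h2 : AnalyticAt ℂ (fun v : ℂ => cofactorY (paramY v)) v := by
    unfold cofactorY
    fun_prop
  exact (h1.mul h2).div analyticAt_const critZ_ne_zero

end CriticalValues

/-- A local coordinate at `critV`: its square is `1 - paramZ v / critZ`. -/
noncomputable def rootParam (v : ℂ) : ℂ := (critV - v) * cofactorV v ^ (1 / 2 : ℂ)

theorem rootParam_sq {v : ℂ} (hv : 1 + v - v ^ 2 ≠ 0) :
    rootParam v ^ 2 = 1 - paramZ v / critZ := by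
  rw [rootParam, mul_pow, cpow_half_sq, one_sub_paramZ_div hv]

theorem cofactorV_critV_mem : cofactorV critV ∈ Complex.slitPlane := by
  rw [cofactorV_critV]
  exact Complex.ofReal_mem_slitPlane.2 (by linarith [critK_bounds.1])

theorem sqrt_cofactorV_critV : cofactorV critV ^ (1 / 2 : ℂ) = (√critK : ℝ) := by
  rw [cofactorV_critV, Real.sqrt_eq_rpow, Complex.ofReal_cpow (by linarith [critK_bounds.1])]
  norm_num

theorem analyticAt_sqrt_cofactorV :
    AnalyticAt ℂ (fun v => cofactorV v ^ (1 / 2 : ℂ)) critV :=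
  (analyticAt_cofactorV norm_critV.le).cpow analyticAt_const cofactorV_critV_mem

theorem analyticAt_rootParam : AnalyticAt ℂ rootParam critV :=
  (analyticAt_const.sub analyticAt_id).mul analyticAt_sqrt_cofactorV

theorem sqrt_critK_pos : 0 < √critK := Real.sqrt_pos.2 (by linarith [critK_bounds.1])

theorem deriv_rootParam : deriv rootParam critV = -(√critK : ℝ) := by
  have h1 : HasDerivAt (fun v : ℂ => (critV : ℂ) - v) (-1) critV :=
    (hasDerivAt_id' _).const_sub _
  have h2 := h1.mul analyticAt_sqrt_cofactorV.differentiableAt.hasDerivAt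
  refine Eq.trans (HasDerivAt.deriv (f := rootParam) h2) ?_
  rw [sqrt_cofactorV_critV]
  ring

namespace OrderedTree

/-- The square root that appears in the singular expansion. -/
noncomputable def sqrtVar (z : ℂ) : ℂ := (1 - z / critZ) ^ (1 / 2 : ℂ)

theorem re_one_sub_div_pos {z : ℂ} (hz : ‖z‖ < critZ) : 0 < (1 - z / critZ).re := by
  have h1 : ‖z / critZ‖ < 1 := by
    rw [norm_div, Complex.norm_real, Real.norm_of_nonneg critZ_pos.le, div_lt_one critZ_pos]
    exact hz
  have h2 := Complex.re_le_norm (z / critZ)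
  rw [Complex.sub_re, Complex.one_re]
  linarith

/-- Near the critical point, the coordinate `rootParam` of `treeV z` is the principal square root.
The two agree up to sign, and the sign is determined by real parts: `critV - treeV z` has positive
real part because `‖treeV z‖ ≤ critV`, and both square roots lie in the sector `|arg| < π / 4`. -/
theorem eventually_rootParam_treeV :
    ∀ᶠ z in 𝓝[Metric.ball 0 critZ] (critZ : ℂ), rootParam (treeV z) = sqrtVar z := by
  have hmem : (critZ : ℂ) ∈ Metric.closedBall (0 : ℂ) critZ := by
    simp [abs_of_pos critZ_pos]
  have hcont : Tendsto treeV (𝓝[Metric.ball 0 critZ] (critZ : ℂ)) (𝓝 critV) := by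
    have := (continuousOn_treeV critZ hmem).mono Metric.ball_subset_closedBall
    rwa [ContinuousWithinAt, treeV_critZ] at this
  have hsec : ∀ᶠ v in 𝓝 (critV : ℂ),
      |(cofactorV v ^ (1 / 2 : ℂ)).im| < (cofactorV v ^ (1 / 2 : ℂ)).re := by
    have hc := analyticAt_sqrt_cofactorV.continuousAt
    have h1 := Complex.continuous_im.continuousAt.comp hc
    have h2 := Complex.continuous_re.continuousAt.comp hc
    refine (h1.abs).eventually_lt h2 ?_
    simp only [Function.comp_apply, sqrt_cofactorV_critV, Complex.ofReal_im, Complex.ofReal_re,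
      abs_zero]
    exact sqrt_critK_pos
  filter_upwards [hcont.eventually hsec, self_mem_nhdsWithin] with z hw hz
  have hz' : ‖z‖ < critZ := by simpa using hz
  have hv := norm_treeV_le hz'.le
  have hre := re_one_sub_div_pos hz'
  have hsq : rootParam (treeV z) ^ 2 = sqrtVar z ^ 2 := by
    rw [rootParam_sq (denom_ne_zero hv), paramZ_treeV hz'.le, sqrtVar, cpow_half_sq]
  rcases sq_eq_sq_iff_eq_or_eq_neg.1 hsq with h | h
  · exact h
  · exfalso
    have hs : |(sqrtVar z).im| < (sqrtVar z).re :=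
      abs_im_lt_re_of_sq (cpow_half_re_nonneg _) (by rw [sqrtVar, cpow_half_sq]; exact hre)
    set w := cofactorV (treeV z) ^ (1 / 2 : ℂ) with hwdef
    have hne : treeV z ≠ critV := by
      intro h0
      rw [rootParam, h0, sub_self, zero_mul] at h
      rw [neg_eq_zero.1 h.symm] at hs
      simp at hs
    have hpos : 0 < (critV - treeV z : ℂ).re := by
      rw [Complex.sub_re, Complex.ofReal_re]
      linarith [re_lt_of_norm_le hv hne]
    have hw' : |(starRingEnd ℂ w).im| < (starRingEnd ℂ w).re := by simpa using hw
    have h3 := re_mul_pos_of_abs_im_lt_re hs hw'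
    -- multiplied by the conjugate of `w`, the assumption `(critV - treeV z) w = -sqrtVar z` reads
    -- as an equality of a number with positive and a number with nonpositive real part
    have h4 : sqrtVar z * starRingEnd ℂ w = -((Complex.normSq w : ℝ) * (critV - treeV z)) := by
      rw [Complex.normSq_eq_conj_mul_self]
      rw [rootParam, ← hwdef] at h
      linear_combination (starRingEnd ℂ w) * h
    rw [h4, Complex.neg_re, Complex.re_ofReal_mul] at h3
    have := mul_nonneg (Complex.normSq_nonneg w) hpos.le
    linarith

end OrderedTree

namespace OrderedTree

/-! ### The generating function `SR` in the open disc -/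

theorem convergesAt_sigma_mul_rho {x : ℝ} (hx : 0 ≤ x) (hx' : x < critZ) :
    ConvergesAt (fun t => t.sigmaIndex * t.rhoIndex) x := by
  have hq : 0 ≤ x / critZ := div_nonneg hx critZ_pos.le
  obtain ⟨K, hK⟩ := (tendsto_self_mul_const_pow_of_lt_one hq
    ((div_lt_one critZ_pos).2 hx')).bddAbove_range
  refine Summable.of_nonneg_of_le (fun t => by positivity) (fun t => ?_)
    (convergesAt_sigmaIndex_mul.1.mul_left K)
  have h1 : (t.order : ℝ) * x ^ t.order ≤ K * critZ ^ t.order := by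
    have := hK ⟨t.order, rfl⟩
    simp only [div_pow] at this
    rwa [← mul_div_assoc, div_le_iff₀ (pow_pos critZ_pos _)] at this
  have h2 : ((t.sigmaIndex * t.rhoIndex : ℕ) : ℝ) ≤
      ((t.sigmaIndex * (1 + t.rootedRho) : ℕ) : ℝ) * t.order := by
    have h3 : t.sigmaIndex * t.rhoIndex ≤ t.sigmaIndex * (1 + t.rootedRho) * t.order := by
      rw [mul_assoc]
      refine Nat.mul_le_mul_left _ ((rhoIndex_le t).trans ?_)
      rw [mul_comm]
      exact Nat.mul_le_mul_right _ (by omega)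
    exact_mod_cast h3
  calc ((t.sigmaIndex * t.rhoIndex : ℕ) : ℝ) * x ^ t.order
      ≤ ((t.sigmaIndex * (1 + t.rootedRho) : ℕ) : ℝ) * t.order * x ^ t.order := by gcongr
    _ = ((t.sigmaIndex * (1 + t.rootedRho) : ℕ) : ℝ) * (t.order * x ^ t.order) := by ring
    _ ≤ ((t.sigmaIndex * (1 + t.rootedRho) : ℕ) : ℝ) * (K * critZ ^ t.order) := by gcongr
    _ = K * (((t.sigmaIndex * (1 + t.rootedRho) : ℕ) : ℝ) * critZ ^ t.order) := by ring

theorem SR_eq_genFun : SR = genFun fun t => t.sigmaIndex * t.rhoIndex := by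
  funext z
  exact tsum_congr fun t => by push_cast; ring

theorem analyticOnNhd_SR : AnalyticOnNhd ℂ SR (Metric.ball 0 critZ) := by
  intro z hz
  have hz' : ‖z‖ < critZ := by simpa using hz
  obtain ⟨x, h1, h2⟩ := exists_between hz'
  have hx : 0 ≤ x := (norm_nonneg z).trans h1.le
  rw [SR_eq_genFun]
  exact (convergesAt_sigma_mul_rho hx h2).analyticOnNhd hx z (by simpa using h1)

theorem SR_eq_paramSR {z : ℂ} (hz : ‖z‖ < critZ) : SR z = paramSR (treeV z) := by
  obtain ⟨e1, e2, e3, e4⟩ := genFun_system hz.le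
  have hv := norm_treeV_le hz.le
  have hy := norm_genFun_sigmaOut_le hz.le
  have hv1 := one_sub_ne_zero hv
  have hy1 := one_sub_ne_zero_of_le_critY hy
  have hy3 := one_sub_three_mul_ne_zero hy
  have hU : genFun (fun t => t.sigmaOut * t.rootedRho) z =
      (1 - genFun sigmaOut z) * treeV z := by
    unfold treeV; field_simp
  rcases eq_or_ne z 0 with rfl | hz0
  · have h0 : ∀ c, genFun c 0 = 0 := fun c => by
      simp [genFun, (order_pos _).ne']
    rw [SR_eq_genFun, paramSR, ← e3, h0, h0, treeV, h0, h0]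
    simp
  · have hx := critZ_pos.le
    have hconv := convergesAt_sigma_mul_rho (norm_nonneg z) hz
    have hle : ∀ t : OrderedTree, t.sigmaOut ≤ t.sigmaIndex ∧ t.sigmaIn ≤ t.sigmaIndex := by
      intro t
      rw [sigmaIndex_eq_add]
      omega
    have s := hconv.summable_norm (norm_nonneg z) le_rfl
    have s0 := (hconv.mono (d := fun t => t.sigmaOut * t.rhoIndex) (norm_nonneg z)
      fun t => Nat.mul_le_mul_right _ (hle t).1).summable_norm (norm_nonneg z) le_rfl
    have s1 := (hconv.mono (d := fun t => t.sigmaIn * t.rhoIndex) (norm_nonneg z)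
      fun t => Nat.mul_le_mul_right _ (hle t).2).summable_norm (norm_nonneg z) le_rfl
    obtain ⟨⟨h1, h1'⟩, ⟨h2, -⟩, ⟨h3, -⟩, ⟨h4, -⟩⟩ := convergesAt_critZ
    have f1 := genFun_marked rootedRho rhoIndex sigmaOut_node rhoIndex_node critZ_pos
      convergesAt_sigmaIndex.1 convergesAt_sigmaIndex.2 hz.le hz0 s s0 (h3.summable_norm hx hz.le)
    have f2 := genFun_marked rootedRho rhoIndex sigmaIn_node rhoIndex_node critZ_pos
      h1 (h1'.trans_lt (by linarith [critY_lt])) hz.le hz0 s0 s1 (h4.summable_norm hx hz.le)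
    have f3 : SR z = genFun (fun t => t.sigmaOut * t.rhoIndex) z +
        genFun (fun t => t.sigmaIn * t.rhoIndex) z := by
      rw [SR_eq_genFun, ← genFun_add s0 s1]
      congr 1; funext t; rw [sigmaIndex_eq]; ring
    rw [← SR_eq_genFun, hU, e2] at f1
    rw [paramSR, ← e3, eq_div_iff hy3]
    have e5 : genFun sigmaOut z / (1 - treeV z) =
        genFun (fun t => t.sigmaIn * t.rootedRho) z / (1 - genFun sigmaOut z) := by
      rw [div_eq_div_iff hv1 hy1, ← e4]
    rw [e5]
    generalize genFun sigmaOut z = y at *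
    generalize treeV z = v at *
    generalize genFun (fun t => t.sigmaOut * t.rhoIndex) z = a at *
    generalize genFun (fun t => t.sigmaIn * t.rhoIndex) z = b at *
    generalize genFun (fun t => t.sigmaIn * t.rootedRho) z = u at *
    -- the equations for `SR` are linear; with `z = y (1 - y)²` the determinant becomes `1 - 3 y`
    have g1 : (a - (1 - y) * v) * (1 - y) ^ 2 = y * SR z := by
      apply mul_left_cancel₀ (pow_ne_zero 2 hy1)
      linear_combination f1 + SR z * e1
    have g2 : b - u = y * a := by
      apply mul_left_cancel₀ (pow_ne_zero 2 hy1)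
      linear_combination f2 + a * e1
    have g3 : (1 - y) ^ 3 * ((1 + y) * v + u / (1 - y)) =
        (1 - y) ^ 3 * (1 + y) * v + (1 - y) ^ 2 * u := by
      field_simp
    rw [g3]
    linear_combination (1 + y) * g1 + (1 - y) ^ 2 * g2 + (1 - y) ^ 2 * f3

/-- At every point of the circle besides `critZ`, the parametrization is locally invertible. -/
theorem exists_continuation_of_ne {w : ℂ} (hw : ‖w‖ = critZ) (hne : w ≠ critZ) :
    ∃ g : ℂ → ℂ, AnalyticAt ℂ g w ∧ g =ᶠ[𝓝[Metric.ball 0 critZ] w] SR := by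
  have hv := norm_treeV_le hw.le
  have hy := norm_paramY_treeV_le hw.le
  have hz := paramZ_treeV hw.le
  have hvne : treeV w ≠ critV := by
    intro h
    rw [h, paramZ_critV] at hz
    exact hne hz.symm
  obtain ⟨g, hg, hg1, -, hg2⟩ := exists_analytic_localInverse (analyticAt_paramZ hv)
    (deriv_paramZ_ne_zero hv hy hvne)
  rw [hz] at hg hg1
  have hcont : Tendsto treeV (𝓝[Metric.ball 0 critZ] w) (𝓝 (treeV w)) :=
    (continuousOn_treeV w (by simp [hw])).mono Metric.ball_subset_closedBall
  have hSR : AnalyticAt ℂ paramSR (g w) := hg1.symm ▸ analyticAt_paramSR hv hy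
  refine ⟨fun z => paramSR (g z), hSR.comp hg, ?_⟩
  filter_upwards [hcont.eventually hg2, self_mem_nhdsWithin] with z h1 h2
  have h2' : ‖z‖ < critZ := by simpa using h2
  rw [paramZ_treeV h2'.le] at h1
  rw [h1, SR_eq_paramSR h2']

/-- Near `critZ`, `SR` is an analytic function of the square root, since `rootParam` is a local
coordinate at `critV`. -/
theorem exists_singular_expansion :
    ∃ G : ℂ → ℂ, AnalyticAt ℂ G 0 ∧ G 0 = critA ∧ deriv G 0 = -critB ∧
      ∀ᶠ z in 𝓝[Metric.ball 0 critZ] (critZ : ℂ), SR z = G (sqrtVar z) := by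
  have hd : deriv rootParam critV ≠ 0 := by
    rw [deriv_rootParam]
    exact neg_ne_zero.2 (by exact_mod_cast sqrt_critK_pos.ne')
  have h0 : rootParam critV = 0 := by simp [rootParam]
  obtain ⟨g, hg, hg1, hg2, hg3⟩ := exists_analytic_localInverse analyticAt_rootParam hd
  rw [h0] at hg hg1 hg2
  have hSR : AnalyticAt ℂ paramSR (g 0) :=
    hg1.symm ▸ analyticAt_paramSR norm_critV.le norm_paramY_critV
  refine ⟨fun s => paramSR (g s), hSR.comp hg, ?_, ?_, ?_⟩
  · change paramSR (g 0) = _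
    rw [hg1, paramSR_critV]
  · refine Eq.trans (deriv_comp (h₂ := paramSR) 0 hSR.differentiableAt hg.differentiableAt) ?_
    rw [hg1, hg2, deriv_paramSR_critV, deriv_rootParam, critB]
    push_cast
    rw [inv_neg, mul_neg, div_eq_mul_inv]
  · have hmem : (critZ : ℂ) ∈ Metric.closedBall (0 : ℂ) critZ := by
      simp [abs_of_pos critZ_pos]
    have hcont : Tendsto treeV (𝓝[Metric.ball 0 critZ] (critZ : ℂ)) (𝓝 critV) := by
      have := (continuousOn_treeV critZ hmem).mono Metric.ball_subset_closedBall
      rwa [ContinuousWithinAt, treeV_critZ] at this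
    filter_upwards [hcont.eventually hg3, eventually_rootParam_treeV, self_mem_nhdsWithin]
      with z h1 h2 h3
    rw [SR_eq_paramSR (by simpa using h3), ← h2, h1]

theorem sqrtVar_sq (z : ℂ) : sqrtVar z ^ 2 = 1 - z / critZ := cpow_half_sq _

theorem tendsto_sqrtVar : Tendsto sqrtVar (𝓝 (critZ : ℂ)) (𝓝 0) := by
  have h1 : Tendsto (fun z : ℂ => ‖1 - z / critZ‖) (𝓝 (critZ : ℂ)) (𝓝 0) := by
    have : ContinuousAt (fun z : ℂ => ‖1 - z / critZ‖) critZ := by fun_prop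
    simpa [ContinuousAt, div_self critZ_ne_zero] using this
  have h2 : ∀ z, ‖sqrtVar z‖ = √‖1 - z / critZ‖ := fun z => by
    rw [← sqrtVar_sq, norm_pow, Real.sqrt_sq (norm_nonneg _)]
  rw [tendsto_zero_iff_norm_tendsto_zero]
  simp only [h2]
  simpa using h1.sqrt

theorem SR_sub_isLittleO :
    (fun z : ℂ => SR z - (critA - critB * sqrtVar z)) =o[𝓝[Metric.ball 0 critZ] (critZ : ℂ)]
      sqrtVar := by
  obtain ⟨G, hG, hG0, hG1, hSR⟩ := exists_singular_expansion
  have h1 := hG.differentiableAt.hasDerivAt.isLittleO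
  rw [hG0, hG1] at h1
  have hs : Tendsto sqrtVar (𝓝[Metric.ball 0 critZ] (critZ : ℂ)) (𝓝 0) :=
    tendsto_sqrtVar.mono_left nhdsWithin_le_nhds
  have h2 := h1.comp_tendsto hs
  refine (h2.congr' ?_ ?_)
  · filter_upwards [hSR] with z hz
    simp only [Function.comp_apply, hz, sub_zero, smul_eq_mul]
    ring
  · exact Eventually.of_forall fun z => by simp

theorem critB_pos : 0 < critB := by linarith [critB_bounds.1]

theorem neBot_nhdsWithin_critZ : (𝓝[Metric.ball 0 critZ] (critZ : ℂ)).NeBot := by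
  rw [← mem_closure_iff_nhdsWithin_neBot, closure_ball _ critZ_pos.ne']
  simp [abs_of_pos critZ_pos]

/-- An analytic function differs from its value by `O(z - critZ)`, which is the square of the
square root; so the square root term would have to vanish. -/
theorem not_continuesAnalyticallyAt : ¬ ContinuesAnalyticallyAt SR critZ critZ := by
  rintro ⟨g, hg, hgSR⟩
  have hne := neBot_nhdsWithin_critZ
  have hl : 𝓝[Metric.ball 0 critZ] (critZ : ℂ) ≤ 𝓝 (critZ : ℂ) := nhdsWithin_le_nhds
  have hs := tendsto_sqrtVar.mono_left hl
  have hsub : (fun z : ℂ => z - critZ) =o[𝓝[Metric.ball 0 critZ] (critZ : ℂ)] sqrtVar := by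
    have h1 : (fun z : ℂ => z - critZ) = fun z => (-critZ * sqrtVar z) * sqrtVar z := by
      funext z
      have := sqrtVar_sq z
      have h2 : z - critZ = -critZ * (1 - z / critZ) := by
        rw [mul_sub, mul_one, neg_mul, mul_div_cancel₀ _ critZ_ne_zero]; ring
      rw [h2, ← this]
      ring
    rw [h1]
    have h2 : Tendsto (fun z => -(critZ : ℂ) * sqrtVar z) (𝓝[Metric.ball 0 critZ] (critZ : ℂ))
        (𝓝 0) := by simpa using hs.const_mul (-(critZ : ℂ))
    simpa using ((isLittleO_one_iff ℂ).2 h2).mul_isBigO (isBigO_refl sqrtVar _)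
  have h1 : (fun z => SR z - g critZ) =o[𝓝[Metric.ball 0 critZ] (critZ : ℂ)] sqrtVar := by
    have := (hg.differentiableAt.isBigO_sub.mono hl).trans_isLittleO hsub
    refine this.congr' ?_ EventuallyEq.rfl
    filter_upwards [hgSR] with z hz
    rw [hz]
  have h2 := SR_sub_isLittleO.sub h1
  have h3 : Tendsto (fun z => (SR z - (critA - critB * sqrtVar z)) - (SR z - g critZ))
      (𝓝[Metric.ball 0 critZ] (critZ : ℂ)) (𝓝 0) := h2.trans_tendsto hs
  have h4 : Tendsto (fun z => (SR z - (critA - critB * sqrtVar z)) - (SR z - g critZ))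
      (𝓝[Metric.ball 0 critZ] (critZ : ℂ)) (𝓝 (g critZ - critA)) := by
    have h5 : (fun z => (SR z - (critA - critB * sqrtVar z)) - (SR z - g critZ)) =
        fun z => (g critZ - critA) + critB * sqrtVar z := by funext z; ring
    rw [h5]
    simpa using (hs.const_mul (critB : ℂ)).const_add (g critZ - critA)
  have h6 := tendsto_nhds_unique h4 h3
  have h7 : (fun z => (critB : ℂ) * sqrtVar z) =o[𝓝[Metric.ball 0 critZ] (critZ : ℂ)]
      sqrtVar := by
    refine h2.congr_left fun z => ?_
    linear_combination h6
  have hB : (critB : ℂ) ≠ 0 := by exact_mod_cast critB_pos.ne'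
  have h8 := (isLittleO_const_mul_left_iff hB).1 h7
  refine isLittleO_irrefl (Eventually.frequently ?_) h8
  filter_upwards [self_mem_nhdsWithin] with z hz hz0
  have h9 := re_one_sub_div_pos (z := z) (by simpa using hz)
  rw [← sqrtVar_sq, hz0] at h9
  simp at h9

theorem isDominantSingularity_critZ : IsDominantSingularity SR (critZ : ℂ) := by
  have hn : ‖(critZ : ℂ)‖ = critZ := by simp [abs_of_pos critZ_pos]
  refine ⟨?_, ?_, ?_⟩ <;> rw [hn]
  · exact analyticOnNhd_SR
  · exact not_continuesAnalyticallyAt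
  · exact fun w hw hne => exists_continuation_of_ne hw hne

end OrderedTree

/-! ### Coefficients of the square root and Catalan numbers -/

/-- The coefficients of the power series of `√(1 - x)`. -/
noncomputable def sqrtCoeff : ℕ → ℝ
  | 0 => 1
  | n + 1 => -(catalan n : ℝ) / (2 * 4 ^ n)

theorem catalan_succ_mul (n : ℕ) : (n + 2) * catalan (n + 1) = 2 * (2 * n + 1) * catalan n := by
  have h1 := succ_mul_catalan_eq_centralBinom n
  have h2 := succ_mul_catalan_eq_centralBinom (n + 1)
  have h3 := Nat.succ_mul_centralBinom_succ n
  rw [← h1, ← h2] at h3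
  apply Nat.eq_of_mul_eq_mul_left (Nat.succ_pos n)
  calc (n + 1) * ((n + 2) * catalan (n + 1)) = 2 * (2 * n + 1) * ((n + 1) * catalan n) := h3
    _ = (n + 1) * (2 * (2 * n + 1) * catalan n) := by ring

theorem sqrtCoeff_succ (n : ℕ) :
    2 * ((n : ℝ) + 1) * sqrtCoeff (n + 1) = (2 * n - 1) * sqrtCoeff n := by
  rcases n with _ | n
  · norm_num [sqrtCoeff]
  · have h : ((n : ℝ) + 2) * catalan (n + 1) = 2 * (2 * n + 1) * catalan n := by
      exact_mod_cast catalan_succ_mul n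
    simp only [sqrtCoeff]
    push_cast
    rw [pow_succ]
    field_simp
    linear_combination (-2) * h

theorem choose_half_eq (n : ℕ) :
    Ring.choose (1 / 2 : ℂ) n * (-1) ^ n = (sqrtCoeff n : ℂ) := by
  induction n with
  | zero => simp [sqrtCoeff]
  | succ n ih =>
    have h1 : ((n : ℂ) + 1) * Ring.choose (1 / 2 : ℂ) (n + 1) =
        (1 / 2 - n) * Ring.choose (1 / 2 : ℂ) n := by
      rw [Ring.choose_eq_smul, Ring.choose_eq_smul, descPochhammer_succ_right,
        Polynomial.smeval_mul, Nat.factorial_succ]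
      have hn : ((n : ℂ) + 1) ≠ 0 := Nat.cast_add_one_ne_zero n
      simp only [Polynomial.smeval_sub, Polynomial.smeval_X, Polynomial.smeval_natCast, pow_one,
        pow_zero, smul_eq_mul, nsmul_eq_mul, mul_one]
      push_cast
      field_simp
    have h2 : 2 * ((n : ℂ) + 1) * sqrtCoeff (n + 1) = (2 * n - 1) * sqrtCoeff n := by
      exact_mod_cast sqrtCoeff_succ n
    have hn : 2 * ((n : ℂ) + 1) ≠ 0 := mul_ne_zero two_ne_zero (Nat.cast_add_one_ne_zero n)
    apply mul_left_cancel₀ hn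
    rw [h2, ← ih, pow_succ]
    linear_combination (-2) * (-1) ^ n * h1

theorem hasSum_sqrtCoeff {x : ℂ} (hx : ‖x‖ < 1) :
    HasSum (fun n => (sqrtCoeff n : ℂ) * x ^ n) ((1 - x) ^ (1 / 2 : ℂ)) := by
  have h := (Complex.one_add_cpow_hasFPowerSeriesOnBall_zero (a := (1 / 2 : ℂ))).hasSum
    (y := -x) (by
      rw [← ENNReal.ofReal_one, Metric.eball_ofReal]
      simpa using hx)
  rw [zero_add, ← sub_eq_add_neg] at h
  refine h.congr_fun fun n => ?_
  rw [binomialSeries_apply, ← choose_half_eq, List.ofFn_const, List.prod_replicate, neg_pow,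
    smul_eq_mul]
  ring

/-- A lower bound of the right order for the central binomial coefficients. -/
theorem sixteen_pow_le_centralBinom_sq (n : ℕ) :
    16 ^ (n + 1) ≤ 4 * (n + 1) * (n + 1).centralBinom ^ 2 := by
  induction n with
  | zero => simp [Nat.centralBinom, Nat.choose]
  | succ n ih =>
    have h := Nat.succ_mul_centralBinom_succ (n + 1)
    have h2 : 16 ^ (n + 1 + 1) * (n + 2) ≤
        (4 * (n + 1 + 1) * (n + 1 + 1).centralBinom ^ 2) * (n + 2) := by
      calc 16 ^ (n + 1 + 1) * (n + 2) = 16 * (n + 2) * 16 ^ (n + 1) := by ring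
        _ ≤ 16 * (n + 2) * (4 * (n + 1) * (n + 1).centralBinom ^ 2) := by gcongr
        _ = 16 * (4 * (n + 1) * (n + 2)) * (n + 1).centralBinom ^ 2 := by ring
        _ ≤ 16 * (2 * (n + 1) + 1) ^ 2 * (n + 1).centralBinom ^ 2 := by gcongr; nlinarith
        _ = 4 * (2 * (2 * (n + 1) + 1) * (n + 1).centralBinom) ^ 2 := by ring
        _ = 4 * ((n + 1 + 1) * (n + 1 + 1).centralBinom) ^ 2 := by rw [h]
        _ = _ := by ring
    exact Nat.le_of_mul_le_mul_right h2 (by omega)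

theorem sqrtCoeff_neg (n : ℕ) : sqrtCoeff (n + 1) < 0 := by
  have h : 0 < catalan n := by
    have := succ_mul_catalan_eq_centralBinom n
    have := Nat.centralBinom_pos n
    by_contra h0
    simp only [not_lt, nonpos_iff_eq_zero] at h0
    simp [h0] at *
    omega
  have : (0 : ℝ) < catalan n := by exact_mod_cast h
  simp only [sqrtCoeff]
  rw [neg_div]
  exact neg_neg_of_pos (by positivity)

theorem sqrtCoeff_lower (n : ℕ) : 1 ≤ 4 * (n + 2) * √(n + 1) * |sqrtCoeff (n + 2)| := by
  have h1 : ((n : ℝ) + 2) * catalan (n + 1) = (n + 1).centralBinom := by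
    exact_mod_cast succ_mul_catalan_eq_centralBinom (n + 1)
  have h2 : ((4 : ℝ) ^ (n + 1)) ^ 2 ≤ (2 * √(n + 1) * (n + 1).centralBinom) ^ 2 := by
    have h3 : (16 : ℝ) ^ (n + 1) ≤ 4 * (n + 1) * (n + 1).centralBinom ^ 2 := by
      exact_mod_cast sixteen_pow_le_centralBinom_sq n
    rw [mul_pow, mul_pow, Real.sq_sqrt (by positivity), ← pow_mul, mul_comm (n + 1) 2, pow_mul]
    norm_num
    exact h3
  have h4 := le_of_sq_le_sq h2 (by positivity)
  rw [abs_of_neg (sqrtCoeff_neg (n + 1))]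
  simp only [sqrtCoeff]
  rw [neg_div, neg_neg, ← mul_div_assoc, le_div_iff₀ (by positivity), one_mul]
  calc (2 : ℝ) * 4 ^ (n + 1) ≤ 2 * (2 * √(n + 1) * (n + 1).centralBinom) := by gcongr
    _ = 4 * (n + 2) * √(n + 1) * catalan (n + 1) := by rw [← h1]; ring

theorem tendsto_sqrtCoeff_ratio :
    Tendsto (fun n => 1 - sqrtCoeff (n + 1) / sqrtCoeff (n + 2)) atTop (𝓝 0) := by
  have h : ∀ n : ℕ, 1 - sqrtCoeff (n + 1) / sqrtCoeff (n + 2) = -3 / (2 * n + 1) := by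
    intro n
    have h1 := sqrtCoeff_succ (n + 1)
    push_cast at h1
    have h2 := (sqrtCoeff_neg (n + 1)).ne
    have h3 : (2 * (n : ℝ) + 1) ≠ 0 := by positivity
    have h4 : sqrtCoeff (n + 1) / sqrtCoeff (n + 2) = 2 * (n + 2) / (2 * n + 1) := by
      rw [div_eq_div_iff h2 h3]
      linear_combination -h1
    rw [h4]
    field_simp
    ring
  simp only [h]
  refine Tendsto.div_atTop tendsto_const_nhds ?_
  exact tendsto_atTop_add_const_right _ _
    (tendsto_natCast_atTop_atTop.const_mul_atTop (by norm_num))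

/-! ### A bound for coefficients -/

/-- If the second derivative is bounded on the disc of convergence, the coefficients are
`O(R⁻ⁿ n⁻²)`. -/
theorem norm_coeff_le_of_deriv_deriv_bounded {c : ℕ → ℂ} {g : ℂ → ℂ} {R M : ℝ} (hR : 0 < R)
    (hg : ∀ z : ℂ, ‖z‖ < R → HasSum (fun n => c n * z ^ n) (g z))
    (hM : ∀ z : ℂ, ‖z‖ < R → ‖deriv (deriv g) z‖ ≤ M) (n : ℕ) :
    ((n : ℝ) + 2) * (n + 1) * ‖c (n + 2)‖ * R ^ n ≤ M := by
  have hball : HasFPowerSeriesOnBall g (FormalMultilinearSeries.ofScalars ℂ c) 0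
      (ENNReal.ofReal R) := by
    refine ⟨?_, ENNReal.ofReal_pos.2 hR, ?_⟩
    · refine ENNReal.le_of_forall_nnreal_lt fun r hr => ?_
      have hr' : (r : ℝ) < R := by
        rw [ENNReal.lt_ofReal_iff_toReal_lt ENNReal.coe_ne_top] at hr
        simpa using hr
      have h0 := (hg (r : ℝ) (by simpa using hr')).summable.tendsto_atTop_zero.norm
      refine FormalMultilinearSeries.le_radius_of_tendsto _ (l := 0) ?_
      simpa [FormalMultilinearSeries.ofScalars_norm] using h0
    · intro y hy
      rw [Metric.eball_ofReal] at hy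
      have := hg y (by simpa using hy)
      rw [zero_add]
      refine this.congr_fun fun n => ?_
      rw [FormalMultilinearSeries.ofScalars_apply_eq, smul_eq_mul]
  have hderiv : ∀ m : ℕ, iteratedDeriv m g 0 = (m.factorial : ℂ) * c m := by
    intro m
    have h := hball.factorial_smul 1 m
    rw [FormalMultilinearSeries.ofScalars_apply_eq] at h
    simpa [iteratedDeriv] using h.symm
  have hdiff : DifferentiableOn ℂ (deriv (deriv g)) (Metric.ball 0 R) := by
    have h1 : AnalyticOnNhd ℂ g (Metric.ball 0 R) := by
      have := hball.analyticOnNhd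
      rwa [Metric.eball_ofReal] at this
    exact h1.deriv.deriv.differentiableOn
  have key : ∀ r : ℝ, 0 < r → r < R →
      ((n : ℝ) + 2) * (n + 1) * ‖c (n + 2)‖ * r ^ n ≤ M := by
    intro r hr hrR
    have h1 : DiffContOnCl ℂ (deriv (deriv g)) (Metric.ball 0 r) := by
      refine DifferentiableOn.diffContOnCl (hdiff.mono ?_)
      rw [closure_ball _ hr.ne']
      exact Metric.closedBall_subset_ball hrR
    have h2 := Complex.norm_iteratedDeriv_le_of_forall_mem_sphere_norm_le n hr h1 (C := M)
      fun z hz => hM z (by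
        have : ‖z‖ = r := by simpa using hz
        rwa [this])
    have h3 : iteratedDeriv n (deriv (deriv g)) 0 = iteratedDeriv (n + 2) g 0 := by
      rw [iteratedDeriv_succ', iteratedDeriv_succ']
    rw [h3, hderiv, norm_mul, Complex.norm_natCast, le_div_iff₀ (pow_pos hr n),
      Nat.factorial_succ, Nat.factorial_succ] at h2
    push_cast at h2
    have h4 : (0 : ℝ) < n.factorial := by exact_mod_cast n.factorial_pos
    refine le_of_mul_le_mul_left ?_ h4
    linarith
  have hlim : Tendsto (fun r : ℝ => ((n : ℝ) + 2) * (n + 1) * ‖c (n + 2)‖ * r ^ n) (𝓝[<] R)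
      (𝓝 (((n : ℝ) + 2) * (n + 1) * ‖c (n + 2)‖ * R ^ n)) :=
    (Continuous.tendsto (by fun_prop) R).mono_left nhdsWithin_le_nhds
  refine le_of_tendsto hlim ?_
  filter_upwards [Ioo_mem_nhdsLT hR] with r hr
  exact key r hr.1 hr.2

/-- A function on the open disc that is bounded near every point of the closed disc is bounded. -/
theorem exists_bound_of_locally_bounded {f : ℂ → ℂ} {R : ℝ}
    (h : ∀ w ∈ Metric.closedBall (0 : ℂ) R, ∃ M : ℝ,
      ∀ᶠ z in 𝓝[Metric.ball 0 R] w, ‖f z‖ ≤ M) :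
    ∃ M : ℝ, ∀ z : ℂ, ‖z‖ < R → ‖f z‖ ≤ M := by
  have := (isCompact_closedBall (0 : ℂ) R).induction_on
    (p := fun s => ∃ M : ℝ, ∀ z ∈ s, ‖z‖ < R → ‖f z‖ ≤ M) ⟨0, by simp⟩
    (fun s t hst ⟨M, hM⟩ => ⟨M, fun z hz => hM z (hst hz)⟩)
    (fun s t ⟨M, hM⟩ ⟨M', hM'⟩ => ⟨max M M', fun z hz hzR => hz.elim
      (fun hz => (hM z hz hzR).trans (le_max_left _ _))
      (fun hz => (hM' z hz hzR).trans (le_max_right _ _))⟩)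
    (fun w hw => by
      obtain ⟨M, hM⟩ := h w hw
      rw [eventually_nhdsWithin_iff] at hM
      exact ⟨_, mem_nhdsWithin_of_mem_nhds hM, M, fun z hz hzR => hz (by simpa using hzR)⟩)
  obtain ⟨M, hM⟩ := this
  exact ⟨M, fun z hz => hM z (by simpa using hz.le) hz⟩

theorem deriv_deriv_bounded_of_eventuallyEq {f g : ℂ → ℂ} {R : ℝ} {w : ℂ}
    (hg : AnalyticAt ℂ g w) (h : f =ᶠ[𝓝[Metric.ball 0 R] w] g) :
    ∃ M : ℝ, ∀ᶠ z in 𝓝[Metric.ball 0 R] w, ‖deriv (deriv f) z‖ ≤ M := by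
  have hc : ContinuousAt (fun z => ‖deriv (deriv g) z‖) w := hg.deriv.deriv.continuousAt.norm
  refine ⟨‖deriv (deriv g) w‖ + 1, ?_⟩
  have h1 := hc.eventually_lt_const (lt_add_one ‖deriv (deriv g) w‖)
  filter_upwards [eventually_eventually_nhdsWithin.2 h, self_mem_nhdsWithin,
    nhdsWithin_le_nhds h1] with z hz hzR hz1
  rw [Metric.isOpen_ball.nhdsWithin_eq hzR] at hz
  have h2 : f =ᶠ[𝓝 z] g := hz
  rw [h2.deriv.deriv_eq]
  exact hz1.le

namespace OrderedTree

/-! ### Coefficient asymptotics -/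

/-- The coefficient of `zⁿ` in `SR`. -/
noncomputable def srCoeff (n : ℕ) : ℝ :=
  ∑ t ∈ treesOfOrder n, (t.sigmaIndex : ℝ) * (t.rhoIndex : ℝ)

theorem hasSum_srCoeff {z : ℂ} (hz : ‖z‖ < critZ) :
    HasSum (fun n => (srCoeff n : ℂ) * z ^ n) (SR z) := by
  have h1 := ((convergesAt_sigma_mul_rho (norm_nonneg z) hz).summable_norm
    (norm_nonneg z) le_rfl).of_norm
  have h2 := h1.hasSum.tsum_fiberwise order
  rw [SR_eq_genFun]
  refine h2.congr_fun fun n => ?_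
  have h3 : order ⁻¹' {n} = (treesOfOrder n : Set OrderedTree) := by
    ext t
    simp [mem_treesOfOrder]
  rw [h3]
  change _ = ∑' t : (treesOfOrder n : Finset OrderedTree), _
  rw [Finset.tsum_subtype (treesOfOrder n)
    (fun t : OrderedTree => ((t.sigmaIndex * t.rhoIndex : ℕ) : ℂ) * z ^ t.order), srCoeff]
  push_cast
  rw [Finset.sum_mul]
  refine Finset.sum_congr rfl fun t ht => ?_
  rw [mem_treesOfOrder.1 ht]

/-- The Taylor expansion of an analytic function at `0` up to the third order, with an analytic
cofactor of `s ^ 4`. -/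
theorem exists_expansion_of_analyticAt {G : ℂ → ℂ} (hG : AnalyticAt ℂ G 0) :
    ∃ (c₂ c₃ : ℂ) (H : ℂ → ℂ), AnalyticAt ℂ H 0 ∧
      ∀ s, G s = G 0 + deriv G 0 * s + c₂ * s ^ 2 + c₃ * s ^ 3 + s ^ 4 * H s := by
  have step : ∀ F : ℂ → ℂ, AnalyticAt ℂ F 0 →
      AnalyticAt ℂ (dslope F 0) 0 ∧ ∀ s, F s = F 0 + s * dslope F 0 s := by
    rintro F ⟨p, hp⟩
    refine ⟨⟨_, hp.has_fpower_series_dslope_fslope⟩, fun s => ?_⟩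
    have := sub_smul_dslope F 0 s
    rw [sub_zero, smul_eq_mul] at this
    linear_combination -this
  obtain ⟨a1, e1⟩ := step G hG
  obtain ⟨a2, e2⟩ := step _ a1
  obtain ⟨a3, e3⟩ := step _ a2
  obtain ⟨a4, e4⟩ := step _ a3
  refine ⟨dslope (dslope G 0) 0 0, dslope (dslope (dslope G 0) 0) 0 0, _, a4, fun s => ?_⟩
  rw [← dslope_same G 0]
  linear_combination e1 s + s * e2 s + s ^ 2 * e3 s + s ^ 3 * e4 s

theorem one_sub_div_mem_slitPlane {w : ℂ} (hw : ‖w‖ ≤ critZ) (hne : w ≠ critZ) :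
    1 - w / critZ ∈ Complex.slitPlane := by
  refine Or.inl ?_
  rw [Complex.sub_re, Complex.one_re, Complex.div_ofReal_re]
  have := re_lt_of_norm_le hw hne
  linarith [(div_lt_one critZ_pos).2 this]

theorem analyticAt_sqrtVar {w : ℂ} (hw : ‖w‖ ≤ critZ) (hne : w ≠ critZ) :
    AnalyticAt ℂ sqrtVar w := by
  have h1 : AnalyticAt ℂ (fun z : ℂ => 1 - z / critZ) w :=
    analyticAt_const.sub (analyticAt_id.div analyticAt_const critZ_ne_zero)
  exact h1.cpow analyticAt_const (one_sub_div_mem_slitPlane hw hne)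

theorem ne_critZ_of_norm_lt {z : ℂ} (hz : ‖z‖ < critZ) : z ≠ critZ := by
  rintro rfl
  simp [abs_of_pos critZ_pos] at hz

theorem sqrtVar_ne_zero {z : ℂ} (hz : ‖z‖ < critZ) : sqrtVar z ≠ 0 := by
  intro h
  have h1 := re_one_sub_div_pos hz
  rw [← sqrtVar_sq, h] at h1
  simp at h1

theorem hasDerivAt_sqrtVar {z : ℂ} (hz : ‖z‖ < critZ) :
    HasDerivAt sqrtVar (-1 / (2 * critZ * sqrtVar z)) z := by
  have h1 := (analyticAt_sqrtVar hz.le (ne_critZ_of_norm_lt hz)).differentiableAt.hasDerivAt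
  have h2 : HasDerivAt (fun z => sqrtVar z ^ 2) (2 * sqrtVar z ^ 1 * deriv sqrtVar z) z := h1.pow 2
  have h3 : HasDerivAt (fun z => sqrtVar z ^ 2) (-(1 / (critZ : ℂ))) z := by
    have : (fun z => sqrtVar z ^ 2) = fun z : ℂ => 1 - z / critZ := funext sqrtVar_sq
    rw [this]
    exact ((hasDerivAt_id' z).div_const _).const_sub 1
  have h4 := h2.unique h3
  have hs := sqrtVar_ne_zero hz
  have h5 : deriv sqrtVar z = -1 / (2 * critZ * sqrtVar z) := by
    rw [eq_div_iff (mul_ne_zero (mul_ne_zero two_ne_zero critZ_ne_zero) hs)]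
    have h6 : (1 / (critZ : ℂ)) * critZ = 1 := one_div_mul_cancel critZ_ne_zero
    linear_combination (critZ : ℂ) * h4 - h6
  rwa [h5] at h1

/-- The effect of `d/dz` on functions of the square root: the order in the square root drops by
two. -/
noncomputable def derivFactor (k : ℕ) (H : ℂ → ℂ) (s : ℂ) : ℂ :=
  -((k + 2) * H s + s * deriv H s) / (2 * critZ)

theorem analyticAt_derivFactor {k : ℕ} {H : ℂ → ℂ} {s : ℂ} (hH : AnalyticAt ℂ H s) :
    AnalyticAt ℂ (derivFactor k H) s := by
  have h1 := hH.deriv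
  exact ((analyticAt_const.mul hH).add (analyticAt_id.mul h1)).neg.div analyticAt_const
    (mul_ne_zero two_ne_zero critZ_ne_zero)

theorem hasDerivAt_sqrtVar_pow_mul {k : ℕ} {H : ℂ → ℂ} {z : ℂ} (hz : ‖z‖ < critZ)
    (hH : AnalyticAt ℂ H (sqrtVar z)) :
    HasDerivAt (fun z => sqrtVar z ^ (k + 2) * H (sqrtVar z))
      (sqrtVar z ^ k * derivFactor k H (sqrtVar z)) z := by
  have h1 := hasDerivAt_sqrtVar hz
  have h2 : HasDerivAt (fun z => H (sqrtVar z)) (deriv H (sqrtVar z) *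
      (-1 / (2 * critZ * sqrtVar z))) z := hH.differentiableAt.hasDerivAt.comp z h1
  have h3 : HasDerivAt (fun z => sqrtVar z ^ (k + 2)) (((k + 2 : ℕ) : ℂ) * sqrtVar z ^ (k + 1) *
      (-1 / (2 * critZ * sqrtVar z))) z := h1.pow (k + 2)
  refine (h3.mul h2).congr_deriv ?_
  have hs := sqrtVar_ne_zero hz
  have hZ := critZ_ne_zero
  unfold derivFactor
  push_cast
  field_simp
  ring

/-- After subtraction of the terms of order `1` and `3` in the square root, the function `SR` has
a bounded second derivative near the dominant singularity. -/
theorem deriv_deriv_bounded_at_critZ {f : ℂ → ℂ} {A B : ℂ} {H : ℂ → ℂ} (hH : AnalyticAt ℂ H 0)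
    (hf : ∀ᶠ z in 𝓝[Metric.ball 0 critZ] (critZ : ℂ),
      f z = A + B * z + sqrtVar z ^ 4 * H (sqrtVar z)) :
    ∃ M : ℝ, ∀ᶠ z in 𝓝[Metric.ball 0 critZ] (critZ : ℂ), ‖deriv (deriv f) z‖ ≤ M := by
  have hs : Tendsto sqrtVar (𝓝[Metric.ball 0 critZ] (critZ : ℂ)) (𝓝 0) :=
    tendsto_sqrtVar.mono_left nhdsWithin_le_nhds
  set H₁ := derivFactor 2 H
  set H₂ := derivFactor 0 H₁
  have hH₁ : AnalyticAt ℂ H₁ 0 := analyticAt_derivFactor hH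
  have hH₂ : AnalyticAt ℂ H₂ 0 := analyticAt_derivFactor hH₁
  have hd1 : ∀ᶠ z in 𝓝[Metric.ball 0 critZ] (critZ : ℂ),
      deriv f z = B + sqrtVar z ^ 2 * H₁ (sqrtVar z) := by
    filter_upwards [eventually_eventually_nhdsWithin.2 hf, self_mem_nhdsWithin,
      hs.eventually hH.eventually_analyticAt] with z hz hzR hHz
    rw [Metric.isOpen_ball.nhdsWithin_eq hzR] at hz
    have h2 : f =ᶠ[𝓝 z] fun z => A + B * z + sqrtVar z ^ 4 * H (sqrtVar z) := hz
    rw [h2.deriv_eq]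
    have h3 : HasDerivAt (fun z => A + B * z) (B * 1) z :=
      ((hasDerivAt_id' z).const_mul B).const_add A
    have h4 := h3.add (hasDerivAt_sqrtVar_pow_mul (k := 2) (by simpa using hzR) hHz)
    rw [mul_one] at h4
    exact h4.deriv
  have hd2 : ∀ᶠ z in 𝓝[Metric.ball 0 critZ] (critZ : ℂ),
      deriv (deriv f) z = H₂ (sqrtVar z) := by
    filter_upwards [eventually_eventually_nhdsWithin.2 hd1, self_mem_nhdsWithin,
      hs.eventually hH₁.eventually_analyticAt] with z hz hzR hHz
    rw [Metric.isOpen_ball.nhdsWithin_eq hzR] at hz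
    have h2 : deriv f =ᶠ[𝓝 z] fun z => B + sqrtVar z ^ 2 * H₁ (sqrtVar z) := hz
    rw [h2.deriv_eq]
    have h4 := (hasDerivAt_sqrtVar_pow_mul (k := 0) (by simpa using hzR) hHz).const_add B
    rw [pow_zero, one_mul] at h4
    exact h4.deriv
  have hc : Tendsto (fun z => ‖H₂ (sqrtVar z)‖) (𝓝[Metric.ball 0 critZ] (critZ : ℂ))
      (𝓝 ‖H₂ 0‖) := (hH₂.continuousAt.tendsto.comp hs).norm
  refine ⟨‖H₂ 0‖ + 1, ?_⟩
  filter_upwards [hd2, hc.eventually_lt_const (lt_add_one _)] with z h1 h2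
  rw [h1]
  exact h2.le

/-- A linear combination of the square root and its cube can be removed from `SR` such that the
second derivative becomes bounded on the whole disc: near `critZ` by the singular expansion, near
every other point of the closed disc by analytic continuation. -/
theorem exists_bounded_remainder :
    ∃ (c : ℂ) (M : ℝ), ∀ z : ℂ, ‖z‖ < critZ →
      ‖deriv (deriv fun z => SR z + critB * sqrtVar z - c * ((1 - z / critZ) * sqrtVar z)) z‖
        ≤ M := by
  obtain ⟨G, hG, hG0, hG1, hSR⟩ := exists_singular_expansion
  obtain ⟨c₂, c₃, H, hH, hexp⟩ := exists_expansion_of_analyticAt hG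
  refine ⟨c₃, exists_bound_of_locally_bounded fun w hw => ?_⟩
  have hw' : ‖w‖ ≤ critZ := by simpa using hw
  rcases eq_or_ne w critZ with rfl | hne
  · refine deriv_deriv_bounded_at_critZ (A := critA + c₂) (B := -c₂ / critZ) hH ?_
    filter_upwards [hSR] with z hz
    have h1 := sqrtVar_sq z
    rw [hz, hexp, hG0, hG1]
    linear_combination (c₂ + c₃ * sqrtVar z) * h1
  · have hs := analyticAt_sqrtVar hw' hne
    have hlin : AnalyticAt ℂ (fun z : ℂ => 1 - z / critZ) w :=
      analyticAt_const.sub (analyticAt_id.div analyticAt_const critZ_ne_zero)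
    obtain ⟨g, hg, hgSR⟩ : ∃ g : ℂ → ℂ, AnalyticAt ℂ g w ∧ g =ᶠ[𝓝[Metric.ball 0 critZ] w] SR := by
      rcases hw'.lt_or_eq with h | h
      · exact ⟨SR, analyticOnNhd_SR w (by simpa using h), EventuallyEq.rfl⟩
      · exact exists_continuation_of_ne h hne
    refine deriv_deriv_bounded_of_eventuallyEq
      (g := fun z => g z + critB * sqrtVar z - c₃ * ((1 - z / critZ) * sqrtVar z))
      ((hg.add (analyticAt_const.mul hs)).sub (analyticAt_const.mul (hlin.mul hs))) ?_
    filter_upwards [hgSR] with z hz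
    rw [hz]

/-- The coefficients of `(1 - x) √(1 - x)`. -/
noncomputable def sqrtCubeCoeff : ℕ → ℝ
  | 0 => 1
  | n + 1 => sqrtCoeff (n + 1) - sqrtCoeff n

theorem hasSum_sqrtCubeCoeff {x : ℂ} (hx : ‖x‖ < 1) :
    HasSum (fun n => (sqrtCubeCoeff n : ℂ) * x ^ n) ((1 - x) * (1 - x) ^ (1 / 2 : ℂ)) := by
  have h := hasSum_sqrtCoeff hx
  have h1 := (hasSum_nat_add_iff' 1).2 h
  have h2 := h1.sub (h.mul_left x)
  rw [← hasSum_nat_add_iff' 1]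
  convert! h2 using 1
  · funext n
    simp only [sqrtCubeCoeff]
    push_cast
    ring
  · simp [sqrtCubeCoeff, sqrtCoeff]
    ring

/-- The square root term alone determines the coefficients of `SR` up to terms of smaller order. -/
theorem exists_coeff_bound :
    ∃ (c : ℂ) (M : ℝ), ∀ n : ℕ, ((n : ℝ) + 2) * (n + 1) *
      ‖(srCoeff (n + 2) * critZ ^ (n + 2) : ℂ) + critB * sqrtCoeff (n + 2) -
        c * (sqrtCoeff (n + 2) - sqrtCoeff (n + 1))‖ ≤ M := by
  obtain ⟨c, M, hM⟩ := exists_bounded_remainder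
  refine ⟨c, M * critZ ^ 2, fun n => ?_⟩
  have hsum : ∀ z : ℂ, ‖z‖ < critZ → HasSum (fun n => ((srCoeff n : ℂ) +
      (critB * sqrtCoeff n - c * sqrtCubeCoeff n) / critZ ^ n) * z ^ n)
      (SR z + critB * sqrtVar z - c * ((1 - z / critZ) * sqrtVar z)) := by
    intro z hz
    have hx : ‖z / critZ‖ < 1 := by
      rw [norm_div, Complex.norm_real, Real.norm_of_nonneg critZ_pos.le, div_lt_one critZ_pos]
      exact hz
    refine (((hasSum_srCoeff hz).add ((hasSum_sqrtCoeff hx).mul_left (critB : ℂ))).sub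
      ((hasSum_sqrtCubeCoeff hx).mul_left c)).congr_fun fun n => ?_
    rw [div_pow]
    ring
  have h := norm_coeff_le_of_deriv_deriv_bounded critZ_pos hsum hM n
  have hZ : (critZ : ℂ) ^ (n + 2) ≠ 0 := pow_ne_zero _ critZ_ne_zero
  have h1 : (srCoeff (n + 2) * critZ ^ (n + 2) : ℂ) + critB * sqrtCoeff (n + 2) -
        c * (sqrtCoeff (n + 2) - sqrtCoeff (n + 1)) =
      ((srCoeff (n + 2) : ℂ) +
        (critB * sqrtCoeff (n + 2) - c * sqrtCubeCoeff (n + 2)) / critZ ^ (n + 2)) *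
        critZ ^ (n + 2) := by
    rw [add_mul, div_mul_cancel₀ _ hZ]
    simp only [sqrtCubeCoeff]
    push_cast
    ring
  have h2 : ‖(critZ : ℂ) ^ (n + 2)‖ = critZ ^ n * critZ ^ 2 := by
    rw [norm_pow, Complex.norm_real, Real.norm_of_nonneg critZ_pos.le, pow_add]
  rw [h1, norm_mul, h2]
  calc _ = ((n : ℝ) + 2) * (n + 1) * ‖(srCoeff (n + 2) : ℂ) +
        (critB * sqrtCoeff (n + 2) - c * sqrtCubeCoeff (n + 2)) / critZ ^ (n + 2)‖ *
        critZ ^ n * critZ ^ 2 := by ring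
    _ ≤ M * critZ ^ 2 := mul_le_mul_of_nonneg_right h (by positivity)

/-- The coefficients of `√(1 - x)` are of order `n ^ (-3 / 2)`; their differences, and the remainder
of order `n ^ (-2)`, are negligible. -/
theorem tendsto_srCoeff_div :
    Tendsto (fun n => srCoeff (n + 2) * critZ ^ (n + 2) / sqrtCoeff (n + 2)) atTop
      (𝓝 (-critB)) := by
  obtain ⟨c, M, hM⟩ := exists_coeff_bound
  have hbound : ∀ n : ℕ, ‖srCoeff (n + 2) * critZ ^ (n + 2) / sqrtCoeff (n + 2) - (-critB)‖ ≤
      ‖c‖ * |1 - sqrtCoeff (n + 1) / sqrtCoeff (n + 2)| + 4 * M / √(n + 1) := by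
    intro n
    have hp := (sqrtCoeff_neg (n + 1)).ne
    have hp' : (sqrtCoeff (n + 2) : ℂ) ≠ 0 := by exact_mod_cast hp
    set E := (srCoeff (n + 2) * critZ ^ (n + 2) : ℂ) + critB * sqrtCoeff (n + 2) -
        c * (sqrtCoeff (n + 2) - sqrtCoeff (n + 1)) with hE
    have h1 : ((srCoeff (n + 2) * critZ ^ (n + 2) / sqrtCoeff (n + 2) - (-critB) : ℝ) : ℂ) =
        c * ((1 - sqrtCoeff (n + 1) / sqrtCoeff (n + 2) : ℝ) : ℂ) + E / sqrtCoeff (n + 2) := by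
      rw [hE]
      push_cast
      field_simp
      ring
    have hs : 0 < √((n : ℝ) + 1) := Real.sqrt_pos.2 (by positivity)
    have h2 : ‖E / sqrtCoeff (n + 2)‖ ≤ 4 * M / √(n + 1) := by
      rw [norm_div, Complex.norm_real, Real.norm_eq_abs, div_le_div_iff₀ (abs_pos.2 hp) hs]
      have h3 := sqrtCoeff_lower n
      have h4 : √((n : ℝ) + 1) * √(n + 1) = n + 1 := Real.mul_self_sqrt (by positivity)
      have hM0 : 0 ≤ M := le_trans (by positivity) (hM n)
      calc ‖E‖ * √(n + 1) = ‖E‖ * √(n + 1) * 1 := by ring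
        _ ≤ ‖E‖ * √(n + 1) * (4 * (n + 2) * √(n + 1) * |sqrtCoeff (n + 2)|) := by gcongr
        _ = 4 * ((n + 2) * (√(n + 1) * √(n + 1)) * ‖E‖) * |sqrtCoeff (n + 2)| := by ring
        _ = 4 * ((n + 2) * (n + 1) * ‖E‖) * |sqrtCoeff (n + 2)| := by rw [h4]
        _ ≤ 4 * M * |sqrtCoeff (n + 2)| := by
          gcongr
          exact hM n
    rw [← Complex.norm_real, h1]
    refine (norm_add_le _ _).trans (add_le_add ?_ h2)
    rw [norm_mul, Complex.norm_real, Real.norm_eq_abs]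
  rw [tendsto_iff_norm_sub_tendsto_zero]
  refine squeeze_zero (fun _ => norm_nonneg _) hbound ?_
  have h1 : Tendsto (fun n => ‖c‖ * |1 - sqrtCoeff (n + 1) / sqrtCoeff (n + 2)|) atTop (𝓝 0) := by
    simpa using tendsto_sqrtCoeff_ratio.abs.const_mul ‖c‖
  have h2 : Tendsto (fun n : ℕ => 4 * M / √((n : ℝ) + 1)) atTop (𝓝 0) :=
    tendsto_const_nhds.div_atTop (Real.tendsto_sqrt_atTop.comp
      (tendsto_atTop_add_const_right _ _ tendsto_natCast_atTop_atTop))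
  simpa using h1.add h2

/-- Both the number of trees and the coefficients of the square root are given by Catalan numbers,
so they cancel. -/
theorem expectation_isEquivalent :
    (fun n : ℕ => expectation (fun t => (t.sigmaIndex : ℝ) * (t.rhoIndex : ℝ)) n)
      ~[atTop] (fun n : ℕ => 2 * critB * (1 / (4 * critZ)) ^ n) := by
  have hB := critB_pos
  have hZ := critZ_pos
  refine (isEquivalent_iff_tendsto_one (Eventually.of_forall fun n => by positivity)).2 ?_
  rw [← tendsto_add_atTop_iff_nat 2]
  have h := tendsto_srCoeff_div.div_const (-critB)
  rw [div_self (neg_ne_zero.2 hB.ne')] at h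
  refine h.congr fun n => ?_
  have h1 : ((treesOfOrder (n + 2)).card : ℝ) = catalan (n + 1) := by
    exact_mod_cast card_treesOfOrder_succ (n + 1)
  have h2 : (catalan (n + 1) : ℝ) = -(2 * 4 ^ (n + 1)) * sqrtCoeff (n + 2) := by
    simp only [sqrtCoeff]
    field_simp
  have h3 : sqrtCoeff (n + 2) ≠ 0 := (sqrtCoeff_neg (n + 1)).ne
  simp only [Pi.div_apply, expectation]
  rw [h1, h2, ← srCoeff, div_pow, one_pow, mul_pow, pow_succ (4 : ℝ) (n + 1)]
  field_simp
  ring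

end OrderedTree

theorem mainTheorem8 :
    ∃ z₀ a b C : ℝ,
      125 * z₀ ^ 3 - 412 * z₀ ^ 2 - 40936 * z₀ + 3844 = 0 ∧
      |z₀ - 0.0938166| ≤ 0.00000005 ∧
      (∀ z : ℂ, ‖z‖ < z₀ → Summable fun t : OrderedTree =>
        (t.sigmaIndex : ℂ) * (t.rhoIndex : ℂ) * z ^ t.order) ∧
      IsDominantSingularity OrderedTree.SR (z₀ : ℂ) ∧
      |a - 0.560623| ≤ 0.0000005 ∧
      |b - 0.683264| ≤ 0.0000005 ∧
      (fun z : ℂ => OrderedTree.SR z - (a - b * (1 - z / z₀) ^ (1 / 2 : ℂ)))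
        =o[𝓝[Metric.ball 0 z₀] (z₀ : ℂ)] (fun z : ℂ => (1 - z / z₀) ^ (1 / 2 : ℂ)) ∧
      |C - 1.36653| ≤ 0.000005 ∧
      |1 / (4 * z₀) - 2.66477| ≤ 0.000005 ∧
      (fun n : ℕ => OrderedTree.expectation (fun t => (t.sigmaIndex : ℝ) * (t.rhoIndex : ℝ)) n)
        ~[atTop] (fun n : ℕ => C * (1 / (4 * z₀)) ^ n) := by
  have hB := critB_bounds
  refine ⟨critZ, critA, critB, 2 * critB, critZ_root, abs_critZ_sub, fun z hz => ?_,
    OrderedTree.isDominantSingularity_critZ, abs_critA_sub, ?_, OrderedTree.SR_sub_isLittleO, ?_,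
    abs_growth_sub, OrderedTree.expectation_isEquivalent⟩
  · have h := ((OrderedTree.convergesAt_sigma_mul_rho (norm_nonneg z) hz).summable_norm
      (norm_nonneg z) le_rfl).of_norm
    exact h.congr fun t => by push_cast; ring
  · rw [abs_le]
    constructor <;> linarith [hB.1, hB.2]
  · rw [abs_le]
    constructor <;> linarith [hB.1, hB.2]
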